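/- Let $s\ge 1$. A free nilpotent group of class $s$ is a group $N$ having a basis, i.e. a subset $B\subseteq N$ such that the homomorphism $F(B)\to N$ from the free group on $B$ extending the inclusion of $B$ is surjective with kernel the $(s+1)$-st term $\gamma_{s+1}(F(B))$ of the lower central series; the rank $|B|$ may be finite or infinite. A symmetry of $N$ is an automorphism of $N$ that inverts all elements of some basis of $N$. Let $\mathrm{IA}(N)$ be the kernel of the natural homomorphism $\mathrm{Aut}(N)\to\mathrm{Aut}(N/[N,N])$; an automorphism $\theta$ of $N$ is called a symmetry modulo $\mathrm{IA}(N)$ if there is a symmetry $\theta'$ of $N$ with $\theta\in\theta'\,\mathrm{IA}(N)$. For $\sigma,\varphi_1,\varphi_2,\ldots\in\mathrm{Aut}(N)$ define $\sigma_m=\sigma_m(\varphi_1,\ldots,\varphi_m)$ by $\sigma_0=\sigma$ and, for $m\ge 0$, $$\sigma_{m+1}=\begin{cases}\varphi_{m+1}\,\sigma_m\,\varphi_{m+1}\,\sigma_m^{-1}, & m \text{ even},\\ \varphi_{m+1}\,\sigma_m\,\varphi_{m+1}\,\sigma_m, & m\text{ odd}.\end{cases}$$ (1) Let $N$ be a free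 nilpotent group of class $s$ and let $\theta\in\mathrm{Aut}(N)$ be an involution (an element of order exactly $2$). Then $\theta$ is a symmetry modulo $\mathrm{IA}(N)$ if and only if $\sigma_s(\theta_1,\ldots,\theta_s)=\mathrm{id}$ for every $\sigma\in\mathrm{Aut}(N)$ and all conjugates $\theta_1,\ldots,\theta_s$ of $\theta$ in $\mathrm{Aut}(N)$. (2) The symmetries modulo $\mathrm{IA}(N)$ form a definable family in the group $\mathrm{Aut}(N)$, uniformly in $N$: there is a formula $\Phi(x)$ without parameters of the first-order language of groups, depending only on $s$, such that for every free nilpotent group $N$ of class $s$ and every $\theta\in\mathrm{Aut}(N)$, $\theta$ is a symmetry modulo $\mathrm{IA}(N)$ if and only if $\mathrm{Aut}(N)\models\Phi(\theta)$. -/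

import Mathlib

universe u

namespace FreeNilp

/-- `B` is a basis (a free generating set) of `N` as a free nilpotent group of class `s`, i.e. as a
free group of the variety of nilpotent groups of class at most `s`: the homomorphism from the free
group on `B` to `N` extending the inclusion of `B` is onto, and its kernel is the term
`γ_{s+1}` of the lower central series (which Mathlib numbers from `0`, so that it has index `s`). -/
structure IsBasis {N : Type u} [Group N] (s : ℕ) (B : Set N) : Prop where
  surjective : Function.Surjective (FreeGroup.lift ((↑) : B → N))
  ker_eq : (FreeGroup.lift ((↑) : B → N)).ker = (⊤ : Subgroup (FreeGroup B)).lowerCentralSeries s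

/-- `N` is a free nilpotent group of class `s`, of arbitrary (finite or infinite) rank. -/
def IsFreeNilpotent (s : ℕ) (N : Type u) [Group N] : Prop :=
  ∃ B : Set N, IsBasis s B

/-- A symmetry of `N`: an automorphism that inverts every element of some basis. -/
def IsSymmetry {N : Type u} [Group N] (s : ℕ) (θ : MulAut N) : Prop :=
  ∃ B : Set N, IsBasis s B ∧ ∀ b ∈ B, θ b = b⁻¹

/-- The homomorphism `Aut N → Aut (N / [N, N])` induced by the natural map `N → N / [N, N]`. -/
def autToAutAb (N : Type u) [Group N] : MulAut N →* MulAut (Abelianization N) where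
  toFun f := f.abelianizationCongr
  map_one' := abelianizationCongr_refl
  map_mul' f g := (abelianizationCongr_trans g f).symm

/-- The group `IA(N)` of the automorphisms of `N` that act trivially on `N / [N, N]`. -/
def IA (N : Type u) [Group N] : Subgroup (MulAut N) :=
  (autToAutAb N).ker

/-- `θ` coincides with some symmetry modulo `IA(N)`. -/
def IsSymmetryModIA {N : Type u} [Group N] (s : ℕ) (θ : MulAut N) : Prop :=
  ∃ θ' : MulAut N, IsSymmetry s θ' ∧ θ'⁻¹ * θ ∈ IA N

/-- The word `σ_m(φ_1, …, φ_m)`: `σ_0 = σ`, and `σ_{m+1}` is `φ_{m+1} σ_m φ_{m+1} σ_m⁻¹` for even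
`m` and `φ_{m+1} σ_m φ_{m+1} σ_m` for odd `m`. The entry `φ i` of the tuple is `φ_{i+1}`. -/
def sigmaWord {G : Type u} [Group G] (σ : G) : (m : ℕ) → (Fin m → G) → G
  | 0, _ => σ
  | m + 1, φ =>
    if Even m then
      φ (Fin.last m) * sigmaWord σ m (Fin.init φ) * φ (Fin.last m) *
        (sigmaWord σ m (Fin.init φ))⁻¹
    else
      φ (Fin.last m) * sigmaWord σ m (Fin.init φ) * φ (Fin.last m) *
        sigmaWord σ m (Fin.init φ)

/-- The function symbols of the first-order language of groups. -/
inductive GroupFunc : ℕ → Type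
  | mul : GroupFunc 2
  | inv : GroupFunc 1
  | one : GroupFunc 0

/-- The first-order language of groups, with symbols for product, inverse and identity. -/
def groupLanguage : FirstOrder.Language :=
  { Functions := GroupFunc
    Relations := fun _ => Empty }

/-- Every group is a structure for the language of groups in the natural way. -/
instance groupStructure (G : Type u) [Group G] : groupLanguage.Structure G where
  funMap := fun {_} f => match f with
    | GroupFunc.mul => fun x => x 0 * x 1
    | GroupFunc.inv => fun x => (x 0)⁻¹
    | GroupFunc.one => fun _ => 1
  RelMap := fun {_} r => nomatch r

end FreeNilp

/-! Let `A = N / [N, N]` and let `γ_k` be the lower central series of `N`. An automorphism is a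
symmetry modulo `IA(N)` exactly when it acts on `A` as `-1` (`isSymmetryModIA_iff`), so both claims
ask how to recognize `-1` inside `Aut(N)`.

Suppose that `θ` acts on `A` as `-1`. Then it acts on `γ_k / γ_{k+1}` as `(-1)^k`. If `σ` is trivial
modulo `γ_{k+1}`, conjugation by `θ` raises the displacement `σ(x) x⁻¹`, taken modulo `γ_{k+2}`, to
the power `(-1)^k` (`ActsTrivially.conj_displacement`). The alternating exponent in the words `σ_m`
cancels this sign, so each letter gains one term of the series and `σ_s` is the identity.

Conversely, an involution acting on `A` as neither `1` nor `-1` has conjugates keeping every `σ_m`,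
for a suitable `σ`, away from `±1` on `A` (`exists_sigmaWord_nonscalar`). This is linear algebra
over `ℤ` with conjugates by unipotents (`TwistsTo.eq_smul_one`), lifted to `N` by
`IsBasis.exists_aut`. An involution acting as `1` cannot occur: the factors `γ_k / γ_{k+1}` have no
2-torsion, so `IA(N)` has no involutions. The torsion statement rests on Magnus' theorem
(`gam_eq_dimSubgroup`), proved for any rank by comparing Lyndon commutators with their leading Lie
polynomials.

For definability, the first claim defines the involutive symmetries modulo `IA(N)`. A product `ρ` of
two of them lies in `IA(N)`; if `θ` acts as `-1`, then `θρθ⁻¹ρ` is trivial modulo `γ_3`, and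
commutation with `s - 2` further products kills it. Conversely, these products include conjugation
by `b⁻²` for every basis element `b`, and in rank at least two the vanishing commutators force `θ(b)
≡ b⁻¹` modulo `γ_2`. Abelian groups are covered by separate disjuncts
(`isSymmetryModIA_iff_firstOrder`). -/

namespace FreeNilp

/-! ### Commutator calculus modulo the lower central series. -/

section Gamma

open scoped commutatorElement

variable {G : Type u} [Group G]

/-- The lower central series in its customary numbering: `gam G 1 = G`. -/
def gam (G : Type u) [Group G] (n : ℕ) : Subgroup G :=
  (⊤ : Subgroup G).lowerCentralSeries (n - 1)

instance gam_normal (n : ℕ) : (gam G n).Normal := by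
  unfold gam; infer_instance

theorem gam_one : gam G 1 = ⊤ := rfl

theorem gam_two : gam G 2 = commutator G := rfl

theorem gam_succ (n : ℕ) (hn : 1 ≤ n) : gam G (n + 1) = ⁅gam G n, (⊤ : Subgroup G)⁆ := by
  obtain ⟨k, rfl⟩ : ∃ k, n = k + 1 := ⟨n - 1, by omega⟩
  rfl

theorem gam_antitone : Antitone (gam G) := fun _ _ h =>
  Subgroup.lowerCentralSeries_antitone _ (Nat.sub_le_sub_right h 1)

theorem map_mem_gam {H : Type*} [Group H] (f : G →* H) (n : ℕ) {x : G} (hx : x ∈ gam G n) :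
    f x ∈ (⊤ : Subgroup H).lowerCentralSeries (n - 1) := by
  have h := Subgroup.map_lowerCentralSeries (⊤ : Subgroup G) f (n - 1)
  have h2 : f x ∈ ((⊤ : Subgroup G).map f).lowerCentralSeries (n - 1) := by
    rw [← h]; exact ⟨x, hx, rfl⟩
  exact Subgroup.lowerCentralSeries_mono _ le_top h2

/-- Induction on `j` by the three subgroups lemma, applied to `⊤`, `gam G i` and `gam G (j + 1)`. -/
theorem commutator_gam_le_aux (j : ℕ) : ∀ i, 1 ≤ i →
    ⁅gam G i, gam G (j + 1)⁆ ≤ gam G (i + (j + 1)) := by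
  induction j with
  | zero => intro i hi; rw [zero_add, gam_succ i hi, gam_one]
  | succ j ih =>
    intro i hi
    rw [gam_succ (j + 1) (by omega), Subgroup.commutator_comm]
    have h1 : ⁅⁅(⊤ : Subgroup G), gam G i⁆, gam G (j + 1)⁆ ≤ gam G (i + (j + 1 + 1)) := by
      rw [Subgroup.commutator_comm ⊤, ← gam_succ i hi]
      refine (ih (i + 1) (by omega)).trans (le_of_eq ?_)
      congr 1; omega
    have h2 : ⁅⁅gam G i, gam G (j + 1)⁆, (⊤ : Subgroup G)⁆ ≤ gam G (i + (j + 1 + 1)) := by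
      refine (Subgroup.commutator_mono (ih i hi) le_rfl).trans (le_of_eq ?_)
      rw [← gam_succ _ (by omega)]; rfl
    -- The three subgroups lemma relative to a normal subgroup `K`, obtained from the case of `⊥` in
    -- the quotient by `K`.
    have key : ∀ (A B C K : Subgroup G), K.Normal → ⁅⁅A, B⁆, C⁆ ≤ K → ⁅⁅B, C⁆, A⁆ ≤ K →
        ⁅⁅C, A⁆, B⁆ ≤ K := by
      intro A B C K hK h1 h2
      have e : ∀ X Y Z : Subgroup G, ⁅⁅X, Y⁆, Z⁆ ≤ K ↔
          ⁅⁅X.map (QuotientGroup.mk' K), Y.map (QuotientGroup.mk' K)⁆,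
            Z.map (QuotientGroup.mk' K)⁆ = ⊥ := by
        intro X Y Z
        rw [← Subgroup.map_commutator, ← Subgroup.map_commutator, Subgroup.map_eq_bot_iff,
          QuotientGroup.ker_mk']
      rw [e] at *
      exact Subgroup.commutator_commutator_eq_bot_of_rotate h1 h2
    exact key _ _ _ _ inferInstance h1 h2

theorem commutator_gam_le (i j : ℕ) : ⁅gam G i, gam G j⁆ ≤ gam G (i + j) := by
  -- By truncated subtraction `gam G 0` is the whole group, so an index `0` only needs normality.
  rcases Nat.eq_zero_or_pos j with rfl | hj
  · exact Subgroup.commutator_le_left _ _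
  rcases Nat.eq_zero_or_pos i with rfl | hi
  · rw [zero_add]; exact Subgroup.commutator_le_right _ _
  obtain ⟨k, rfl⟩ : ∃ k, j = k + 1 := ⟨j - 1, by omega⟩
  exact commutator_gam_le_aux k i hi

theorem comm_mem_gam {i j n : ℕ} (h : n ≤ i + j) {x y : G} (hx : x ∈ gam G i) (hy : y ∈ gam G j) :
    ⁅x, y⁆ ∈ gam G n :=
  gam_antitone h (commutator_gam_le i j (Subgroup.commutator_mem_commutator hx hy))

theorem mem_gam_one (x : G) : x ∈ gam G 1 := Subgroup.mem_top x

/-- Equality modulo `gam G n`. -/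
def Cong (n : ℕ) (x y : G) : Prop := (x : G ⧸ gam G n) = (y : G ⧸ gam G n)

theorem Cong.refl {n : ℕ} (x : G) : Cong n x x := Eq.refl _

theorem Cong.symm {n : ℕ} {x y : G} (h : Cong n x y) : Cong n y x := Eq.symm h

theorem Cong.trans {n : ℕ} {x y z : G} (h : Cong n x y) (h' : Cong n y z) : Cong n x z :=
  Eq.trans h h'

theorem Cong.mul {n : ℕ} {x y x' y' : G} (h : Cong n x y) (h' : Cong n x' y') :
    Cong n (x * x') (y * y') := by
  unfold Cong at *; simp only [QuotientGroup.mk_mul, h, h']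

theorem Cong.inv {n : ℕ} {x y : G} (h : Cong n x y) : Cong n x⁻¹ y⁻¹ := by
  unfold Cong at *; simp only [QuotientGroup.mk_inv, h]

theorem Cong.zpow {n : ℕ} {x y : G} (h : Cong n x y) (e : ℤ) : Cong n (x ^ e) (y ^ e) := by
  unfold Cong at *; simp only [QuotientGroup.mk_zpow, h]

theorem Cong.mono {m n : ℕ} (hmn : m ≤ n) {x y : G} (h : Cong n x y) : Cong m x y := by
  unfold Cong at *
  rw [QuotientGroup.eq] at *
  exact gam_antitone hmn h

theorem cong_one_iff {n : ℕ} {x : G} : Cong n x 1 ↔ x ∈ gam G n := by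
  unfold Cong; rw [QuotientGroup.mk_one, QuotientGroup.eq_one_iff]

theorem cong_iff_mul_inv {n : ℕ} {x y : G} : Cong n x y ↔ x * y⁻¹ ∈ gam G n := by
  rw [← cong_one_iff]; unfold Cong
  rw [QuotientGroup.mk_mul, QuotientGroup.mk_inv, QuotientGroup.mk_one, mul_inv_eq_one]

theorem Cong.mem {m n : ℕ} {x y : G} (h : Cong n x y) (hmn : m ≤ n) (hy : y ∈ gam G m) :
    x ∈ gam G m := cong_one_iff.1 ((h.mono hmn).trans (cong_one_iff.2 hy))

theorem Cong.map {n : ℕ} {H : Type u} [Group H] (f : G →* H) {x y : G} (h : Cong n x y) :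
    Cong n (f x) (f y) := by
  rw [cong_iff_mul_inv] at *
  have := map_mem_gam f n h
  rwa [map_mul, map_inv] at this

theorem cong_mul_comm {i j n : ℕ} (h : n ≤ i + j) {x y : G} (hx : x ∈ gam G i)
    (hy : y ∈ gam G j) : Cong n (x * y) (y * x) := by
  rw [cong_iff_mul_inv]
  have := comm_mem_gam h hx hy
  rwa [commutatorElement_def, mul_assoc, ← mul_inv_rev] at this

theorem cong_conj {i n : ℕ} (h : n ≤ i + 1) (g : G) {x : G} (hx : x ∈ gam G i) :
    Cong n (g * x * g⁻¹) x := by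
  rw [cong_iff_mul_inv, ← commutatorElement_def]
  exact comm_mem_gam (i := 1) (by omega) (mem_gam_one g) hx

/-- The exact identity has `a⁅x, y⁆a⁻¹` in place of `⁅x, y⁆`. The depth `m` of `a` is kept separate:
`m = 1` gives linearity of the bracket on a factor, while a deeper `a` gives the precision needed
for the Jacobi identity. -/
theorem comm_mul_left_cong {m i j n : ℕ} (h : n ≤ m + (i + j)) {a x y : G} (ha : a ∈ gam G m)
    (hx : x ∈ gam G i) (hy : y ∈ gam G j) : Cong n ⁅a * x, y⁆ (⁅x, y⁆ * ⁅a, y⁆) := by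
  have : ⁅a * x, y⁆ = (a * ⁅x, y⁆ * a⁻¹) * ⁅a, y⁆ := by simp [commutatorElement_def, mul_assoc]
  rw [this]
  refine Cong.mul ?_ (Cong.refl _)
  rw [cong_iff_mul_inv, ← commutatorElement_def]
  exact comm_mem_gam h ha (comm_mem_gam le_rfl hx hy)

/-- Commutation with `y`, as a homomorphism between factors of the lower central series. -/
def bracketHom (i j : ℕ) (y : G) (hy : y ∈ gam G j) : gam G i →* G ⧸ gam G (i + j + 1) where
  toFun x := ((⁅(x : G), y⁆ : G) : G ⧸ gam G (i + j + 1))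
  map_one' := by simp
  map_mul' a b := by
    have h1 := comm_mul_left_cong (n := i + j + 1) (m := 1) (by omega) (mem_gam_one (a : G)) b.2 hy
    have h2 := cong_mul_comm (n := i + j + 1) (i := i + j) (j := 1)
      (by omega) (comm_mem_gam le_rfl b.2 hy) (mem_gam_one ⁅(a : G), y⁆)
    exact h1.trans h2

theorem comm_congr_left {i j : ℕ} {x x' y : G} (hx' : x' ∈ gam G i)
    (hy : y ∈ gam G j) (h : Cong (i + 1) x x') : Cong (i + j + 1) ⁅x, y⁆ ⁅x', y⁆ := by
  have e : x = (x * x'⁻¹) * x' := by group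
  have h1 : Cong (i + j + 1) ⁅(x * x'⁻¹) * x', y⁆ _ :=
    comm_mul_left_cong (m := 1) (by omega) (mem_gam_one (x * x'⁻¹)) hx' hy
  rw [← e] at h1
  refine h1.trans ?_
  have h2 : Cong (i + j + 1) ⁅x * x'⁻¹, y⁆ 1 :=
    cong_one_iff.2 (comm_mem_gam (by omega) (cong_iff_mul_inv.1 h) hy)
  simpa using (Cong.refl ⁅x', y⁆).mul h2

theorem comm_swap_cong {n : ℕ} {x y x' y' : G} (h : Cong n ⁅x, y⁆ ⁅x', y'⁆) :
    Cong n ⁅y, x⁆ ⁅y', x'⁆ := by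
  rw [← commutatorElement_inv x, ← commutatorElement_inv x']; exact h.inv

theorem comm_congr {i j n : ℕ} (hn : n ≤ i + j + 1) {x x' y y' : G}
    (hx' : x' ∈ gam G i) (hy : y ∈ gam G j) (hy' : y' ∈ gam G j) (h : Cong (i + 1) x x')
    (h' : Cong (j + 1) y y') : Cong n ⁅x, y⁆ ⁅x', y'⁆ := by
  have h1 := comm_congr_left hx' hy h
  have h2 := comm_congr_left hy' hx' h'
  exact (h1.mono hn).trans (comm_swap_cong (h2.mono (by omega)))

theorem comm_zpow_left {i j n : ℕ} (hn : n ≤ i + j + 1) {x y : G} (hx : x ∈ gam G i)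
    (hy : y ∈ gam G j) (e : ℤ) : Cong n ⁅x ^ e, y⁆ (⁅x, y⁆ ^ e) := by
  have h : Cong (i + j + 1) ⁅x ^ e, y⁆ (⁅x, y⁆ ^ e) :=
    map_zpow (bracketHom i j y hy) (⟨x, hx⟩ : gam G i) e
  exact h.mono hn

theorem comm_zpow {i j n : ℕ} (hn : n ≤ i + j + 1) {x y : G} (hx : x ∈ gam G i)
    (hy : y ∈ gam G j) (d e : ℤ) : Cong n ⁅x ^ d, y ^ e⁆ (⁅x, y⁆ ^ (d * e)) := by
  have h1 := comm_zpow_left hn hx (zpow_mem hy e) d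
  have h2 := (comm_zpow_left (n := n) (by omega) hy hx e).inv
  rw [commutatorElement_inv, ← inv_zpow, commutatorElement_inv] at h2
  refine h1.trans ?_
  rw [mul_comm d e, zpow_mul]
  exact h2.zpow d

/-- A subgroup that contains the commutators of `y` with the elements of `S` contains the
commutators of `y` with everything generated by `S` modulo the next term. -/
theorem comm_mem_of_closure {i j : ℕ} (H : Subgroup G) (hH : gam G (i + j + 1) ≤ H) {S : Set G}
    (hS : S ⊆ gam G i) {y : G} (hy : y ∈ gam G j) (hSy : ∀ s ∈ S, ⁅s, y⁆ ∈ H) {x : G}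
    (hx : x ∈ Subgroup.closure S ⊔ gam G (i + 1)) : ⁅x, y⁆ ∈ H := by
  let K : Subgroup G :=
    ((H.map (QuotientGroup.mk' (gam G (i + j + 1)))).comap (bracketHom i j y hy)).map
      (gam G i).subtype
  have hmemH : ∀ z : G, (z : G ⧸ gam G (i + j + 1)) ∈ H.map (QuotientGroup.mk' _) ↔ z ∈ H := by
    intro z
    have : z ∈ (H.map (QuotientGroup.mk' (gam G (i + j + 1)))).comap (QuotientGroup.mk' _) ↔
        z ∈ H := by
      rw [Subgroup.comap_map_eq, QuotientGroup.ker_mk', sup_eq_left.2 hH]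
    exact this
  have hK : ∀ z, z ∈ gam G i → ⁅z, y⁆ ∈ H → z ∈ K := fun z hz h =>
    ⟨⟨z, hz⟩, (hmemH _).2 h, rfl⟩
  have hle : Subgroup.closure S ⊔ gam G (i + 1) ≤ K := by
    refine sup_le ((Subgroup.closure_le _).2 fun z hz => hK z (hS hz) (hSy z hz)) fun z hz => ?_
    exact hK z (gam_antitone (Nat.le_succ i) hz) (hH (comm_mem_gam (by omega) hz hy))
  obtain ⟨z, hz, rfl⟩ := hle hx
  exact (hmemH _).1 hz

/-- The Jacobi identity modulo the lower central series, as a membership statement. -/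
theorem comm_jacobi_mem {i j k : ℕ} (hi : 1 ≤ i) (hj : 1 ≤ j) (hk : 1 ≤ k) (H : Subgroup G)
    (hH : gam G (i + j + k + 1) ≤ H) {a b c : G} (ha : a ∈ gam G i) (hb : b ∈ gam G j)
    (hc : c ∈ gam G k) (h1 : ⁅⁅c, b⁆, a⁆ ∈ H) (h2 : ⁅⁅c, a⁆, b⁆ ∈ H) : ⁅⁅a, b⁆, c⁆ ∈ H := by
  set n := i + j + k + 1 with hn
  have hx : ⁅c, a⁆ ∈ gam G (k + i) := comm_mem_gam le_rfl hc ha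
  have hy : ⁅c, b⁆ ∈ gam G (k + j) := comm_mem_gam le_rfl hc hb
  have hab : ⁅a, b⁆ ∈ gam G (i + j) := comm_mem_gam le_rfl ha hb
  -- Conjugation by `c` replaces `a` by `⁅c, a⁆a` and `b` by `⁅c, b⁆b`. Expanding both slots modulo
  -- `gam G n` yields the Jacobi identity in the form `e9`.
  have h0 : c * ⁅a, b⁆ * c⁻¹ = ⁅⁅c, a⁆ * a, ⁅c, b⁆ * b⁆ := by
    simp [commutatorElement_def, mul_assoc]
  have hw : ⁅c, b⁆ * b ∈ gam G j := mul_mem (gam_antitone (by omega) hy) hb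
  have e1 : Cong n ⁅⁅c, a⁆ * a, ⁅c, b⁆ * b⁆ (⁅a, ⁅c, b⁆ * b⁆ * ⁅⁅c, a⁆, ⁅c, b⁆ * b⁆) :=
    comm_mul_left_cong (by omega) hx ha hw
  have e2 : Cong n ⁅⁅c, b⁆ * b, a⁆ (⁅b, a⁆ * ⁅⁅c, b⁆, a⁆) :=
    comm_mul_left_cong (by omega) hy hb ha
  have e3 : Cong n ⁅⁅c, b⁆ * b, ⁅c, a⁆⁆ (⁅b, ⁅c, a⁆⁆ * ⁅⁅c, b⁆, ⁅c, a⁆⁆) :=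
    comm_mul_left_cong (by omega) hy hb hx
  have e4 : Cong n ⁅⁅c, b⁆, ⁅c, a⁆⁆ 1 := cong_one_iff.2 (comm_mem_gam (by omega) hy hx)
  have e5 : Cong n ⁅⁅c, a⁆, ⁅c, b⁆ * b⁆ ⁅⁅c, a⁆, b⁆ := by
    refine comm_swap_cong (e3.trans ?_)
    simpa using (Cong.refl ⁅b, ⁅c, a⁆⁆).mul e4
  have e6 : Cong n ⁅a, ⁅c, b⁆ * b⁆ (⁅⁅c, b⁆, a⁆⁻¹ * ⁅a, b⁆) := by
    have := e2.inv
    rwa [commutatorElement_inv, mul_inv_rev, commutatorElement_inv b a] at this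
  have e7 : Cong n (c * ⁅a, b⁆ * c⁻¹) (⁅⁅c, b⁆, a⁆⁻¹ * ⁅a, b⁆ * ⁅⁅c, a⁆, b⁆) := by
    rw [h0]; exact e1.trans (e6.mul e5)
  have e8 : ⁅⁅a, b⁆, c⁆ = ⁅a, b⁆ * (c * ⁅a, b⁆ * c⁻¹)⁻¹ := by
    simp [commutatorElement_def, mul_assoc]
  have e9 : Cong n ⁅⁅a, b⁆, c⁆ (⁅⁅c, a⁆, b⁆⁻¹ * ⁅⁅c, b⁆, a⁆) := by
    rw [e8]
    refine ((Cong.refl ⁅a, b⁆).mul e7.inv).trans ?_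
    have : ⁅a, b⁆ * (⁅⁅c, b⁆, a⁆⁻¹ * ⁅a, b⁆ * ⁅⁅c, a⁆, b⁆)⁻¹ =
        ⁅a, b⁆ * ⁅⁅c, a⁆, b⁆⁻¹ * ⁅a, b⁆⁻¹ * ⁅⁅c, b⁆, a⁆ := by group
    rw [this]
    exact (cong_conj (i := k + i + j) (by omega) _
      (inv_mem (comm_mem_gam le_rfl hx hb))).mul (Cong.refl _)
  have := mul_mem (hH (cong_iff_mul_inv.1 e9)) (mul_mem (inv_mem h2) h1)
  rwa [mul_inv_rev, inv_inv, mul_assoc, mul_assoc, mul_inv_cancel_left, inv_mul_cancel,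
    mul_one] at this

/-- An endomorphism that acts as `ε` on the abelianization acts as `ε ^ k` on the `k`-th factor
of the lower central series. -/
theorem cong_zpow_of_cong_two (f : G →* G) (ε : ℤ) (hf : ∀ x, Cong 2 (f x) (x ^ ε)) (k : ℕ)
    (hk : 1 ≤ k) : ∀ x ∈ gam G k, Cong (k + 1) (f x) (x ^ (ε ^ k)) := by
  induction k, hk using Nat.le_induction with
  | base => intro x _; simpa using hf x
  | succ k hk ih =>
    intro x hx
    rw [gam_succ k hk, Subgroup.commutator_def] at hx
    -- Membership is carried through the induction because powers are multiplicative only on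
    -- elements that commute modulo the next term.
    have key : x ∈ gam G (k + 1) ∧ Cong (k + 1 + 1) (f x) (x ^ (ε ^ (k + 1))) := by
      induction hx using Subgroup.closure_induction with
      | mem z hz =>
        obtain ⟨x, hx, y, -, rfl⟩ := hz
        refine ⟨comm_mem_gam (j := 1) le_rfl hx (mem_gam_one y), ?_⟩
        rw [map_commutatorElement]
        have h1 := ih x hx
        have h2 : Cong 2 (f y) (y ^ ε) := hf y
        have hfx : f x ∈ gam G k := h1.mem (Nat.le_succ k) (zpow_mem hx _)
        refine (comm_congr (i := k) (j := 1) le_rfl (zpow_mem hx (ε ^ k)) (mem_gam_one _)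
          (mem_gam_one _) h1 h2).trans ?_
        rw [pow_succ]
        exact comm_zpow le_rfl hx (mem_gam_one y) _ _
      | one => exact ⟨one_mem _, by simpa using Cong.refl _⟩
      | mul a b _ _ ha hb =>
        refine ⟨mul_mem ha.1 hb.1, ?_⟩
        rw [map_mul]
        refine (ha.2.mul hb.2).trans (Cong.symm ?_)
        have hc : Commute (a : G ⧸ gam G (k + 1 + 1)) (b : G ⧸ gam G (k + 1 + 1)) :=
          cong_mul_comm (j := 1) le_rfl ha.1 (mem_gam_one b)
        exact hc.mul_zpow _
      | inv a _ ha =>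
        refine ⟨inv_mem ha.1, ?_⟩
        rw [map_inv, inv_zpow]; exact ha.2.inv
    exact key.2

end Gamma
end FreeNilp

namespace FreeNilp

/-! ### Lyndon words and generators of the factors of the lower central series. -/

section Lyndon

open scoped commutatorElement

variable {X : Type u}

/-- The foliage of a tree. -/
def word : FreeMagma X → List X
  | .of x => [x]
  | .mul a b => word a ++ word b

/-- The number of leaves of a tree. -/
def size (t : FreeMagma X) : ℕ := (word t).length

theorem size_mul (a b : FreeMagma X) : size (.mul a b) = size a + size b := by
  simp [size, word]

theorem size_pos (t : FreeMagma X) : 1 ≤ size t := by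
  induction t using FreeMagma.rec with
  | of x => simp [size, word]
  | mul a b iha ihb => rw [size_mul]; omega

theorem word_ne_nil (t : FreeMagma X) : word t ≠ [] := by
  have := size_pos t
  rintro h
  simp [size, h] at this

open Classical in
/-- The coefficient of a word in the Lie polynomial of a tree (for words of the right length). -/
noncomputable def coef : FreeMagma X → List X → ℤ
  | .of x, w => if w = [x] then 1 else 0
  | .mul a b, w => coef a (w.take (size a)) * coef b (w.drop (size a)) -
      coef b (w.take (size b)) * coef a (w.drop (size b))

section Span

variable {G : Type u} [Group G] (e : X → G)

/-- The iterated commutator of shape `t`. -/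
def evalTree : FreeMagma X → G
  | .of x => e x
  | .mul a b => ⁅evalTree a, evalTree b⁆

theorem evalTree_mem (t : FreeMagma X) : evalTree e t ∈ gam G (size t) := by
  induction t using FreeMagma.rec with
  | of x => exact mem_gam_one _
  | mul a b iha ihb => rw [size_mul]; exact comm_mem_gam le_rfl iha ihb

end Span

variable [LinearOrder X]

theorem list_lt_append (u : List X) {v : List X} (hv : v ≠ []) : u < u ++ v := by
  induction u with
  | nil => cases v with
    | nil => exact absurd rfl hv
    | cons x v => exact List.Lex.nil
  | cons x u ih => exact List.Lex.cons ih

theorem list_le_append (u v : List X) : u ≤ u ++ v := by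
  rcases eq_or_ne v [] with rfl | hv
  · simp
  · exact (list_lt_append u hv).le

theorem list_append_lt_append_left (w : List X) {u v : List X} (h : u < v) : w ++ u < w ++ v := by
  induction w with
  | nil => exact h
  | cons x w ih => exact List.Lex.cons ih

/-- Either `u` is a proper prefix of `v`, or the words differ at some position, and then no
continuation can change the comparison. -/
theorem list_lt_cases {u : List X} : ∀ {v : List X}, u < v →
    (∃ c, c ≠ [] ∧ v = u ++ c) ∨ ∀ x y, u ++ x < v ++ y := by
  induction u with
  | nil =>
    intro v h
    exact Or.inl ⟨v, fun hv => by rw [hv] at h; exact lt_irrefl _ h, rfl⟩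
  | cons a u ih =>
    intro v h
    cases h with
    | cons h' =>
      rcases ih h' with ⟨c, hc, rfl⟩ | h2
      · exact Or.inl ⟨c, hc, rfl⟩
      · exact Or.inr fun x y => List.Lex.cons (h2 x y)
    | rel h' => exact Or.inr fun x y => List.Lex.rel h'

theorem list_append_lt_append_of_length {u u' : List X} (hl : u.length = u'.length) (h : u < u')
    (x y : List X) : u ++ x < u' ++ y := by
  rcases list_lt_cases h with ⟨c, hc, rfl⟩ | h2
  · exact absurd (by simpa using hl) hc
  · exact h2 x y

theorem list_append_le_append_of_length {u u' v v' : List X} (hl : u.length = u'.length)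
    (h : u ≤ u') (h' : v ≤ v') : u ++ v ≤ u' ++ v' := by
  rcases h.eq_or_lt with rfl | h
  · rcases h'.eq_or_lt with rfl | h'
    · exact le_rfl
    · exact (list_append_lt_append_left u h').le
  · exact (list_append_lt_append_of_length hl h v v').le

/-- On words of bounded length over a well-ordered alphabet the lexicographic order is
well-founded. -/
theorem wellFounded_lex_bounded [WellFoundedLT X] (n : ℕ) :
    WellFounded fun l l' : {l : List X // l.length ≤ n} => l.1 < l'.1 := by
  induction n with
  | zero =>
    refine ⟨fun a => ⟨_, fun b hb => ?_⟩⟩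
    have ha : a.1 = [] := List.eq_nil_of_length_eq_zero (Nat.le_zero.1 a.2)
    have hb' : b.1 = [] := List.eq_nil_of_length_eq_zero (Nat.le_zero.1 b.2)
    rw [ha, hb'] at hb
    exact absurd hb (lt_irrefl _)
  | succ n ih =>
    -- A word is compared by its first letter and then by its tail; the empty word receives the
    -- bottom element as its first letter.
    let f : {l : List X // l.length ≤ n + 1} → WithBot X × {l : List X // l.length ≤ n} :=
      fun l => (l.1.head?, ⟨l.1.tail, by have := l.2; rw [List.length_tail]; omega⟩)
    refine Subrelation.wf (r := InvImage (Prod.Lex (· < ·) (fun l l' => l.1 < l'.1)) f) ?_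
      (InvImage.wf f (WellFounded.prod_lex wellFounded_lt ih))
    rintro ⟨l, hl⟩ ⟨l', hl'⟩ h
    cases l' with
    | nil => cases h
    | cons y l' =>
      cases l with
      | nil => exact Prod.Lex.left _ _ (WithBot.bot_lt_coe y)
      | cons x l =>
        cases h with
        | cons h' => exact Prod.Lex.right _ h'
        | rel h' => exact Prod.Lex.left _ _ (WithBot.coe_lt_coe.2 h')

/-- The trees of the standard bracketings of Lyndon words. -/
inductive LyndonTree : FreeMagma X → Prop
  | of (x : X) : LyndonTree (.of x)
  | mul {a b : FreeMagma X} (ha : LyndonTree a) (hb : LyndonTree b) (hab : word a < word b)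
      (h : ∀ a₁ a₂, a = .mul a₁ a₂ → word b ≤ word a₂) : LyndonTree (.mul a b)

theorem append_lt_of_lyndon {u v : List X} (hu : u ≠ []) (h : u < v)
    (hv : ∀ p q, v = p ++ q → p ≠ [] → q ≠ [] → v < q) : u ++ v < v := by
  rcases list_lt_cases h with ⟨c, hc, rfl⟩ | h2
  · exact list_append_lt_append_left u (hv u c rfl hu hc)
  · simpa using h2 v []

/-- The Lyndon property needs, in its inductive step, that the right factor is the least proper
suffix, so the two are proved together. -/
theorem LyndonTree.suffix {t : FreeMagma X} (ht : LyndonTree t) :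
    (∀ p q, word t = p ++ q → p ≠ [] → q ≠ [] → word t < q) ∧
    ∀ a b, t = .mul a b → ∀ p q, word t = p ++ q → p ≠ [] → q ≠ [] → word b ≤ q := by
  induction ht with
  | of x =>
    refine ⟨fun p q h hp hq => ?_, fun a b h => by cases h⟩
    have := congrArg List.length h
    have h1 := List.length_pos_iff.2 hp
    have h2 := List.length_pos_iff.2 hq
    simp [word] at this
    omega
  | @mul a b ha hb hab h iha ihb =>
    have key : ∀ p q, word a ++ word b = p ++ q → p ≠ [] → q ≠ [] → word b ≤ q := by
      intro p q hpq hp hq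
      rcases List.append_eq_append_iff.1 hpq with ⟨c, rfl, hc⟩ | ⟨c, hc, rfl⟩
      · rcases eq_or_ne c [] with rfl | hc0
        · rw [List.nil_append] at hc; exact hc.le
        · exact (ihb.1 c q hc hc0 hq).le
      · rcases eq_or_ne c [] with rfl | hc0
        · exact le_rfl
        · cases a with
          | of x =>
            have := congrArg List.length hc
            have h1 := List.length_pos_iff.2 hp
            have h2 := List.length_pos_iff.2 hc0
            simp [word] at this
            omega
          | mul a₁ a₂ =>
            exact ((h a₁ a₂ rfl).trans (iha.2 a₁ a₂ rfl p c hc hp hc0)).trans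
              (list_le_append c _)
    refine ⟨fun p q hpq hp hq => ?_, fun a' b' hab' => ?_⟩
    · exact (append_lt_of_lyndon (word_ne_nil a) hab ihb.1).trans_le (key p q hpq hp hq)
    · cases hab'; exact key

theorem LyndonTree.append_lt {a b : FreeMagma X} (hb : LyndonTree b) (hab : word a < word b) :
    word a ++ word b < word b :=
  append_lt_of_lyndon (word_ne_nil a) hab hb.suffix.1

/-- The right factor is the least proper suffix of the foliage, so the word determines the splitting
at the root and, inductively, the whole tree. -/
theorem LyndonTree.eq_of_word_eq {t : FreeMagma X} (ht : LyndonTree t) :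
    ∀ {t' : FreeMagma X}, LyndonTree t' → word t = word t' → t = t' := by
  have len : ∀ (x : X) (a b : FreeMagma X), [x] ≠ word a ++ word b := by
    intro x a b h
    have := congrArg List.length h
    have h1 := List.length_pos_iff.2 (word_ne_nil a)
    have h2 := List.length_pos_iff.2 (word_ne_nil b)
    simp at this
    omega
  induction ht with
  | of x =>
    intro t' ht' h
    cases ht' with
    | of y => simp [word] at h; rw [h]
    | mul => exact absurd h (len x _ _)
  | @mul a b ha hb hab h iha ihb =>
    intro t' ht' hw
    have ht : LyndonTree (.mul a b) := .mul ha hb hab h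
    cases ht' with
    | of y => exact absurd hw.symm (len y _ _)
    | @mul a' b' ha' hb' hab' h' =>
      have h1 := ht.suffix.2 a b rfl (word a') (word b') hw (word_ne_nil _) (word_ne_nil _)
      have h2 := (LyndonTree.mul ha' hb' hab' h').suffix.2 a' b' rfl (word a) (word b) hw.symm
        (word_ne_nil _) (word_ne_nil _)
      have hbb : word b = word b' := le_antisymm h1 h2
      have haa : word a = word a' := by
        change word a ++ word b = word a' ++ word b' at hw
        rw [hbb] at hw
        exact List.append_cancel_right hw
      rw [iha ha' haa, ihb hb' hbb]

/-- Triangularity of the Lie polynomials: in `ab - ba` the words of the second product are at least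
`word b ++ word a`, which exceeds `word a ++ word b`. The foliage is therefore the least word and
occurs with coefficient `1`. -/
theorem LyndonTree.coef_spec {t : FreeMagma X} (ht : LyndonTree t) :
    coef t (word t) = 1 ∧ ∀ w : List X, w.length = size t → w < word t → coef t w = 0 := by
  induction ht with
  | of x =>
    refine ⟨by simp [coef, word], fun w _ hlt => ?_⟩
    have : w ≠ [x] := fun h => by rw [h] at hlt; exact lt_irrefl _ hlt
    simp [coef, this]
  | @mul a b ha hb hab h iha ihb =>
    have zero : ∀ (c d : FreeMagma X),
        (∀ w : List X, w.length = size c → w < word c → coef c w = 0) →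
        (∀ w : List X, w.length = size d → w < word d → coef d w = 0) →
        ∀ w : List X, w.length = size c + size d → w < word c ++ word d →
        coef c (w.take (size c)) * coef d (w.drop (size c)) = 0 := by
      intro c d hc hd w hw hlt
      by_contra hne
      have h1 := left_ne_zero_of_mul hne
      have h2 := right_ne_zero_of_mul hne
      have l1 : (w.take (size c)).length = size c := by rw [List.length_take]; omega
      have l2 : (w.drop (size c)).length = size d := by rw [List.length_drop]; omega
      have g1 : word c ≤ w.take (size c) := not_lt.1 fun hh => h1 (hc _ l1 hh)
      have g2 : word d ≤ w.drop (size c) := not_lt.1 fun hh => h2 (hd _ l2 hh)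
      have := list_append_le_append_of_length (by rw [l1]; rfl) g1 g2
      rw [List.take_append_drop] at this
      exact absurd hlt (not_lt.2 this)
    have hlt : word a ++ word b < word b ++ word a :=
      (hb.append_lt hab).trans_le (list_le_append _ _)
    constructor
    · change coef a ((word a ++ word b).take (size a)) * coef b ((word a ++ word b).drop (size a)) -
        coef b ((word a ++ word b).take (size b)) * coef a ((word a ++ word b).drop (size b)) = 1
      rw [zero b a ihb.2 iha.2 _ (by simp [size, add_comm]) hlt]
      simp only [size, List.take_left, List.drop_left, iha.1, ihb.1]
      norm_num
    · intro w hw hwlt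
      rw [size_mul] at hw
      change coef a (w.take (size a)) * coef b (w.drop (size a)) -
        coef b (w.take (size b)) * coef a (w.drop (size b)) = 0
      rw [zero a b iha.2 ihb.2 w hw hwlt, zero b a ihb.2 iha.2 w (by omega) (lt_trans hwlt hlt)]
      norm_num

section Span

variable {G : Type u} [Group G] (e : X → G)

/-- The commutators of the Lyndon trees of size `n` whose foliage precedes `m`. -/
def lyndonBelow (n : ℕ) (m : List X) : Set G :=
  {g | ∃ t, LyndonTree t ∧ size t = n ∧ word t < m ∧ evalTree e t = g}

theorem lyndonBelow_subset (n : ℕ) (m : List X) : lyndonBelow e n m ⊆ gam G n := by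
  rintro _ ⟨t, -, rfl, -, rfl⟩
  exact evalTree_mem e t

/-- Rewriting by induction on the total size and then on the foliage of `b`. If the bracket of `a`
and `b` is not standard, then `a = a₁a₂` with `a₂ < b`, and Jacobi passes to `⁅⁅b, a₂⁆, a₁⁆` and
`⁅⁅b, a₁⁆, a₂⁆`. The inner brackets are smaller, hence expressed by Lyndon commutators below `b`;
bracketing these with `a₁` or `a₂` gives pairs whose larger member is below `b`. -/
theorem comm_mem_closure_lyndonBelow [WellFoundedLT X] (n : ℕ) :
    ∀ a b : FreeMagma X, LyndonTree a → LyndonTree b → size a + size b = n → word a < word b →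
      ⁅evalTree e a, evalTree e b⁆ ∈
        Subgroup.closure (lyndonBelow e n (word b)) ⊔ gam G (n + 1) := by
  induction n using Nat.strong_induction_on with
  | _ n ihn =>
  suffices H : ∀ m : {l : List X // l.length ≤ n}, ∀ a b : FreeMagma X, LyndonTree a →
      LyndonTree b → size a + size b = n → word a < word b → word b = m.1 →
      ⁅evalTree e a, evalTree e b⁆ ∈
        Subgroup.closure (lyndonBelow e n (word b)) ⊔ gam G (n + 1) by
    intro a b ha hb hn hab
    exact H ⟨word b, by change size b ≤ n; omega⟩ a b ha hb hn hab rfl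
  refine (wellFounded_lex_bounded n).fix ?_
  intro m ihm a b ha hb hn hab hbm
  by_cases hstd : ∀ a₁ a₂, a = .mul a₁ a₂ → word b ≤ word a₂
  · exact (le_sup_left : _ ≤ Subgroup.closure (lyndonBelow e n (word b)) ⊔ gam G (n + 1))
      (Subgroup.subset_closure
        ⟨.mul a b, .mul ha hb hab hstd, by rw [size_mul, hn], hb.append_lt hab, rfl⟩)
  push Not at hstd
  obtain ⟨a₁, a₂, rfl, h2⟩ := hstd
  cases ha with
  | mul ha₁ ha₂ h12 _ =>
  have h1 : word a₁ < word b := lt_trans (list_lt_append _ (word_ne_nil a₂)) hab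
  set H := Subgroup.closure (lyndonBelow e n (word b)) ⊔ gam G (n + 1) with hH
  have hgam : gam G (n + 1) ≤ H := le_sup_right
  rw [size_mul] at hn
  have hb1 := size_pos b
  have pair : ∀ c d : FreeMagma X, LyndonTree c → LyndonTree d → size c + size d = n →
      word c < word d → word d < word b → ⁅evalTree e c, evalTree e d⁆ ∈ H := by
    intro c d hc hd hcd hlt hdb
    have := ihm ⟨word d, by change size d ≤ n; omega⟩ (by rw [← hbm]; exact hdb) c d hc hd hcd hlt
      rfl
    refine sup_le_sup_right (Subgroup.closure_mono ?_) _ this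
    rintro _ ⟨t, ht, hs, hlt', rfl⟩
    exact ⟨t, ht, hs, hlt'.trans hdb, rfl⟩
  have triple : ∀ c d : FreeMagma X, LyndonTree c → LyndonTree d → word c < word b →
      word d < word b → size c + size b + size d = n →
      ⁅⁅evalTree e b, evalTree e c⁆, evalTree e d⁆ ∈ H := by
    intro c d hc hd hcb hdb hcd
    have hd1 := size_pos d
    have h3 := ihn (size c + size b) (by omega) c b hc hb rfl hcb
    have h4 := inv_mem h3
    rw [commutatorElement_inv] at h4
    refine comm_mem_of_closure (j := size d) H (by rw [hcd]; exact hgam) (lyndonBelow_subset e _ _)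
      (evalTree_mem e d) ?_ h4
    rintro _ ⟨t, ht, hts, htb, rfl⟩
    rcases lt_trichotomy (word t) (word d) with h | h | h
    · exact pair t d ht hd (by omega) h hdb
    · rw [ht.eq_of_word_eq hd h, commutatorElement_self]; exact one_mem H
    · have := inv_mem (pair d t hd ht (by omega) h htb)
      rwa [commutatorElement_inv] at this
  exact comm_jacobi_mem (size_pos a₁) (size_pos a₂) (size_pos b) H (by rw [hn]; exact hgam)
    (evalTree_mem e a₁) (evalTree_mem e a₂) (evalTree_mem e b)
    (triple a₂ a₁ ha₂ ha₁ h2 h1 (by omega)) (triple a₁ a₂ ha₁ ha₂ h1 h2 (by omega))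

/-- The commutators of the Lyndon trees of size `n`. -/
def lyndonComms (n : ℕ) : Set G := {g | ∃ t, LyndonTree t ∧ size t = n ∧ evalTree e t = g}

theorem gam_le_closure_lyndonComms [WellFoundedLT X] (he : Subgroup.closure (Set.range e) = ⊤)
    (n : ℕ) (hn : 1 ≤ n) : gam G n ≤ Subgroup.closure (lyndonComms e n) ⊔ gam G (n + 1) := by
  induction n, hn using Nat.le_induction with
  | base =>
    rw [gam_one, ← he]
    refine le_trans (Subgroup.closure_mono ?_) le_sup_left
    rintro _ ⟨x, rfl⟩
    exact ⟨.of x, .of x, rfl, rfl⟩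
  | succ n hn ih =>
    set H := Subgroup.closure (lyndonComms e (n + 1)) ⊔ gam G (n + 1 + 1) with hH
    have hgam : gam G (n + 1 + 1) ≤ H := le_sup_right
    have pair : ∀ c d : FreeMagma X, LyndonTree c → LyndonTree d → size c + size d = n + 1 →
        word c < word d → ⁅evalTree e c, evalTree e d⁆ ∈ H := by
      intro c d hc hd hcd hlt
      refine sup_le_sup_right (Subgroup.closure_mono ?_) _
        (comm_mem_closure_lyndonBelow e (n + 1) c d hc hd hcd hlt)
      rintro _ ⟨t, ht, hs, -, rfl⟩
      exact ⟨t, ht, hs, rfl⟩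
    rw [gam_succ n hn, Subgroup.commutator_le]
    intro x hx y _
    -- Bilinearity reduces `x` to a Lyndon commutator of size `n` and then `y` to a single letter;
    -- the pair is finally ordered by foliage.
    refine comm_mem_of_closure (i := n) (j := 1) H hgam ?_ (mem_gam_one y) ?_ (ih hx)
    · rintro _ ⟨t, -, rfl, rfl⟩; exact evalTree_mem e t
    rintro _ ⟨t, ht, hts, rfl⟩
    rw [← commutatorElement_inv]
    refine inv_mem (comm_mem_of_closure (i := 1) (j := n) (S := Set.range e) H
      (by rw [add_comm 1 n]; exact hgam) (fun z _ => mem_gam_one z)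
      (by rw [← hts]; exact evalTree_mem e t) ?_ ?_)
    · rintro _ ⟨x, rfl⟩
      rcases lt_trichotomy [x] (word t) with h | h | h
      · exact pair (.of x) t (.of x) ht (by rw [hts, add_comm]; rfl) h
      · have : e x = evalTree e t := by rw [ht.eq_of_word_eq (.of x) h.symm]; rfl
        rw [this, commutatorElement_self]; exact one_mem H
      · have := inv_mem (pair t (.of x) ht (.of x) (by rw [hts]; rfl) h)
        rwa [commutatorElement_inv] at this
    · rw [he]; exact Subgroup.mem_sup_left (Subgroup.mem_top y)

end Span

end Lyndon
end FreeNilp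

namespace FreeNilp

/-! ### The Magnus representation and dimension subgroups of a free group. -/

section Magnus

open scoped commutatorElement

variable {X : Type u}

/-- The additive operators on functions on words, i.e. on formal power series in non-commuting
variables. -/
abbrev SeriesEnd (X : Type u) : Type u := Module.End ℤ (List X → ℤ)

/-- The operators that raise the order of a series by at least `k`. -/
def raising (X : Type u) (k : ℕ) : Submodule ℤ (SeriesEnd X) where
  carrier := {φ | ∀ (m : ℕ) (f : List X → ℤ), (∀ w, w.length < m → f w = 0) →
    ∀ w, w.length < m + k → φ f w = 0}
  zero_mem' := fun _ _ _ _ _ => rfl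
  add_mem' := fun ha hb m f hf w hw => by
    rw [LinearMap.add_apply, Pi.add_apply, ha m f hf w hw, hb m f hf w hw, add_zero]
  smul_mem' := fun c φ h m f hf w hw => by
    rw [LinearMap.smul_apply, Pi.smul_apply, h m f hf w hw, smul_zero]

theorem raising_mul {j k n : ℕ} (hn : n ≤ j + k) {φ ψ : SeriesEnd X} (hφ : φ ∈ raising X j)
    (hψ : ψ ∈ raising X k) : φ * ψ ∈ raising X n := fun m f hf w hw =>
  hφ (m + k) (ψ f) (fun v hv => hψ m f hf v hv) w (by omega)

theorem raising_antitone : Antitone (raising X) := fun _ _ h _ hφ m f hf w hw =>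
  hφ m f hf w (by omega)

theorem one_mem_raising : (1 : SeriesEnd X) ∈ raising X 0 := fun _ _ hf w hw => hf w hw

/-- Left multiplication by the homogeneous polynomial of degree `n` with coefficients `κ`. -/
def homogOp (n : ℕ) (κ : List X → ℤ) : SeriesEnd X where
  toFun f w := if n ≤ w.length then κ (w.take n) * f (w.drop n) else 0
  map_add' f g := by
    funext w
    simp only [Pi.add_apply]
    split_ifs <;> ring
  map_smul' c f := by
    funext w
    simp only [Pi.smul_apply, smul_eq_mul, RingHom.id_apply]
    split_ifs <;> ring

theorem homogOp_apply (n : ℕ) (κ f : List X → ℤ) (w : List X) :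
    homogOp n κ f w = if n ≤ w.length then κ (w.take n) * f (w.drop n) else 0 := rfl

theorem homogOp_mem (n : ℕ) (κ : List X → ℤ) : homogOp n κ ∈ raising X n := by
  intro m f hf w hw
  rw [homogOp_apply]
  split_ifs with h
  · rw [hf _ (by rw [List.length_drop]; omega), mul_zero]
  · rfl

theorem homogOp_add (n : ℕ) (κ l : List X → ℤ) :
    homogOp n (κ + l) = homogOp n κ + homogOp n l := by
  ext f w
  simp only [LinearMap.add_apply, Pi.add_apply, homogOp_apply]
  split_ifs <;> ring

theorem homogOp_neg (n : ℕ) (κ : List X → ℤ) : homogOp n (-κ) = -homogOp n κ := by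
  ext f w
  simp only [LinearMap.neg_apply, Pi.neg_apply, homogOp_apply]
  split_ifs <;> ring

theorem homogOp_sub (n : ℕ) (κ l : List X → ℤ) :
    homogOp n (κ - l) = homogOp n κ - homogOp n l := by
  rw [sub_eq_add_neg, homogOp_add, homogOp_neg, sub_eq_add_neg]

theorem homogOp_zero (n : ℕ) : homogOp n (0 : List X → ℤ) = 0 := by
  ext f w
  simp [homogOp_apply]

theorem homogOp_mul (n m : ℕ) (κ l : List X → ℤ) :
    homogOp n κ * homogOp m l =
      homogOp (n + m) (fun w => κ (w.take n) * l (w.drop n)) := by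
  refine LinearMap.ext fun f => funext fun w => ?_
  rw [Module.End.mul_apply]
  simp only [homogOp_apply, List.length_drop]
  by_cases h : n + m ≤ w.length
  · rw [if_pos (by omega), if_pos (by omega), if_pos h, List.take_take, List.drop_take,
      List.drop_drop, Nat.min_eq_left (Nat.le_add_right n m), Nat.add_sub_cancel_left, mul_assoc]
  · rw [if_neg h]
    by_cases h' : n ≤ w.length
    · rw [if_pos h', if_neg (by omega), mul_zero]
    · rw [if_neg h']

theorem eq_zero_of_homogOp_mem {n : ℕ} {κ : List X → ℤ} (h : homogOp n κ ∈ raising X (n + 1))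
    {w : List X} (hw : w.length = n) : κ w = 0 := by
  classical
  -- Applied to the constant series `1`, the operator returns its own coefficients.
  have := h 0 (fun v => if v = [] then 1 else 0) (fun v hv => absurd hv (Nat.not_lt_zero _)) w
    (by omega)
  rw [homogOp_apply, if_pos hw.ge, List.take_of_length_le hw.le, List.drop_of_length_le hw.le,
    if_pos rfl, mul_one] at this
  exact this

/-- The inverse of `1 + x` as an operator on series. -/
noncomputable def invOp (x : X) : SeriesEnd X where
  -- The equation `(1 + x) g = f` is solved for `g` by recursion on the length of the word.
  toFun f := fun w => List.rec (f []) (fun y v r => f (y :: v) - coef (.of x) [y] * r) w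
  map_add' f g := by
    funext w
    induction w with
    | nil => rfl
    | cons y w ih =>
      simp only [Pi.add_apply] at ih ⊢
      rw [ih]; ring
  map_smul' c f := by
    funext w
    induction w with
    | nil => rfl
    | cons y w ih =>
      simp only [Pi.smul_apply, smul_eq_mul, RingHom.id_apply] at ih ⊢
      rw [ih]; ring

theorem invOp_nil (x : X) (f : List X → ℤ) : invOp x f [] = f [] := rfl

theorem invOp_cons (x y : X) (f : List X → ℤ) (w : List X) :
    invOp x f (y :: w) = f (y :: w) - coef (.of x) [y] * invOp x f w := rfl

theorem homogOp_one_nil (κ f : List X → ℤ) : homogOp 1 κ f [] = 0 := rfl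

theorem homogOp_one_cons (κ f : List X → ℤ) (y : X) (w : List X) :
    homogOp 1 κ f (y :: w) = κ [y] * f w := by
  rw [homogOp_apply, if_pos (by simp)]; rfl

/-- Left multiplication by `1 + x`. -/
noncomputable def magnusUnit (x : X) : (SeriesEnd X)ˣ where
  val := 1 + homogOp 1 (coef (.of x))
  inv := invOp x
  val_inv := by
    refine LinearMap.ext fun f => funext fun w => ?_
    simp only [Module.End.mul_apply, LinearMap.add_apply, Pi.add_apply, Module.End.one_apply]
    cases w with
    | nil => rw [invOp_nil, homogOp_one_nil, add_zero]
    | cons y w => rw [invOp_cons, homogOp_one_cons]; ring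
  inv_val := by
    refine LinearMap.ext fun f => funext fun w => ?_
    simp only [Module.End.mul_apply, LinearMap.add_apply, Module.End.one_apply]
    induction w with
    | nil => rw [invOp_nil, Pi.add_apply, homogOp_one_nil, add_zero]
    | cons y w ih => rw [invOp_cons, ih, Pi.add_apply, homogOp_one_cons]; ring

/-- The Magnus representation of a free group. -/
noncomputable def magnus : FreeGroup X →* (SeriesEnd X)ˣ := FreeGroup.lift magnusUnit

/-- The value of the Magnus representation, as an operator. -/
noncomputable def magnusOp (g : FreeGroup X) : SeriesEnd X := (magnus g : SeriesEnd X)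

theorem magnusOp_one : magnusOp (1 : FreeGroup X) = 1 := by simp [magnusOp]

theorem magnusOp_mul (g h : FreeGroup X) : magnusOp (g * h) = magnusOp g * magnusOp h := by
  simp [magnusOp]

theorem magnusOp_mul_inv (g : FreeGroup X) : magnusOp g * magnusOp g⁻¹ = 1 := by
  rw [← magnusOp_mul, mul_inv_cancel, magnusOp_one]

theorem magnusOp_of (x : X) :
    magnusOp (FreeGroup.of x) = 1 + homogOp 1 (coef (.of x)) := by
  simp [magnusOp, magnus, magnusUnit]

theorem magnusOp_mem (g : FreeGroup X) :
    magnusOp g ∈ raising X 0 ∧ magnusOp g - 1 ∈ raising X 1 := by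
  have h0 : ∀ φ : SeriesEnd X, φ - 1 ∈ raising X 1 → φ ∈ raising X 0 := fun φ h => by
    have := add_mem (raising_antitone (Nat.zero_le 1) h) one_mem_raising
    rwa [sub_add_cancel] at this
  have hinv : ∀ x : X, magnusOp (FreeGroup.of x)⁻¹ ∈ raising X 0 := by
    intro x m f hf w
    have : magnusOp (FreeGroup.of x)⁻¹ = invOp x := by
      simp only [magnusOp, magnus, map_inv, FreeGroup.lift_apply_of]; rfl
    rw [this]
    induction w with
    | nil => intro hw; exact hf _ hw
    | cons y w ih =>
      intro hw
      rw [invOp_cons, hf _ hw, ih (by simp at hw; simp; omega), mul_zero, sub_zero]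
  suffices H : magnusOp g - 1 ∈ raising X 1 from ⟨h0 _ H, H⟩
  induction g using FreeGroup.induction_on with
  | C1 => rw [magnusOp_one, sub_self]; exact zero_mem _
  | of x => rw [magnusOp_of, add_sub_cancel_left]; exact homogOp_mem _ _
  | inv_of x h =>
    have e : magnusOp (FreeGroup.of x)⁻¹ - 1 =
        -((magnusOp (FreeGroup.of x) - 1) * magnusOp (FreeGroup.of x)⁻¹) := by
      rw [sub_mul, magnusOp_mul_inv, one_mul, neg_sub]
    rw [e]
    exact neg_mem (raising_mul le_rfl h (hinv x))
  | mul g h hg hh =>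
    have e : magnusOp (g * h) - 1 = (magnusOp g - 1) * magnusOp h + (magnusOp h - 1) := by
      rw [magnusOp_mul]; noncomm_ring
    rw [e]
    exact add_mem (raising_mul le_rfl hg (h0 _ hh)) hh

/-- The dimension subgroups of a free group. -/
def dimSubgroup (X : Type u) (n : ℕ) : Subgroup (FreeGroup X) where
  carrier := {g | magnusOp g - 1 ∈ raising X n}
  one_mem' := by
    change magnusOp 1 - 1 ∈ raising X n
    rw [magnusOp_one, sub_self]; exact zero_mem _
  mul_mem' := by
    intro g h hg hh
    change magnusOp (g * h) - 1 ∈ raising X n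
    have e : magnusOp (g * h) - 1 = (magnusOp g - 1) * magnusOp h + (magnusOp h - 1) := by
      rw [magnusOp_mul]; noncomm_ring
    rw [e]
    exact add_mem (raising_mul (k := 0) le_rfl hg (magnusOp_mem h).1) hh
  inv_mem' := by
    intro g hg
    change magnusOp g⁻¹ - 1 ∈ raising X n
    have e : magnusOp g⁻¹ - 1 = -((magnusOp g - 1) * magnusOp g⁻¹) := by
      rw [sub_mul, magnusOp_mul_inv, one_mul, neg_sub]
    rw [e]
    exact neg_mem (raising_mul le_rfl hg (magnusOp_mem g⁻¹).1)

theorem mem_dimSubgroup {n : ℕ} {g : FreeGroup X} :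
    g ∈ dimSubgroup X n ↔ magnusOp g - 1 ∈ raising X n := Iff.rfl

/-- `⁅g, h⁆ - 1 = (gh - hg)(hg)⁻¹`, and the difference `gh - hg` is unchanged when `1` is subtracted
from `g` and `h`. The orders of `g - 1` and `h - 1` therefore add up. -/
theorem magnusOp_comm_sub_one (g h : FreeGroup X) :
    magnusOp ⁅g, h⁆ - 1 = ((magnusOp g - 1) * (magnusOp h - 1) -
      (magnusOp h - 1) * (magnusOp g - 1)) * magnusOp (g⁻¹ * h⁻¹) := by
  have e1 : magnusOp ⁅g, h⁆ = magnusOp g * magnusOp h * magnusOp (g⁻¹ * h⁻¹) := by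
    rw [commutatorElement_def, mul_assoc, magnusOp_mul, magnusOp_mul]
  have e2 : magnusOp h * magnusOp g * magnusOp (g⁻¹ * h⁻¹) = 1 := by
    rw [← magnusOp_mul, ← magnusOp_mul, ← mul_inv_rev, mul_inv_cancel, magnusOp_one]
  rw [e1]
  nth_rewrite 1 [← e2]
  noncomm_ring

theorem gam_le_dimSubgroup (n : ℕ) (hn : 1 ≤ n) : gam (FreeGroup X) n ≤ dimSubgroup X n := by
  induction n, hn using Nat.le_induction with
  | base => intro g _; exact (magnusOp_mem g).2
  | succ n hn ih =>
    rw [gam_succ n hn, Subgroup.commutator_le]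
    intro g hg h _
    rw [mem_dimSubgroup, magnusOp_comm_sub_one]
    refine raising_mul (k := 0) le_rfl (sub_mem ?_ ?_) (magnusOp_mem _).1
    · exact raising_mul le_rfl (ih hg) (magnusOp_mem h).2
    · exact raising_mul (by omega) (magnusOp_mem h).2 (ih hg)

/-- The Magnus expansion of `g` starts with the polynomial of degree `n` with coefficients `κ`. -/
def Lead (g : FreeGroup X) (n : ℕ) (κ : List X → ℤ) : Prop :=
  magnusOp g - 1 - homogOp n κ ∈ raising X (n + 1)

theorem Lead.mem {g : FreeGroup X} {n : ℕ} {κ : List X → ℤ} (h : Lead g n κ) :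
    g ∈ dimSubgroup X n := by
  have := add_mem (raising_antitone (Nat.le_succ n) h) (homogOp_mem n κ)
  rwa [sub_add_cancel] at this

theorem lead_zero_iff {g : FreeGroup X} {n : ℕ} : Lead g n 0 ↔ g ∈ dimSubgroup X (n + 1) := by
  rw [Lead, homogOp_zero, sub_zero, mem_dimSubgroup]

theorem Lead.eq_zero {g : FreeGroup X} {n : ℕ} {κ : List X → ℤ} (h : Lead g n κ)
    (hg : g ∈ dimSubgroup X (n + 1)) {w : List X} (hw : w.length = n) : κ w = 0 := by
  refine eq_zero_of_homogOp_mem ?_ hw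
  have := sub_mem (mem_dimSubgroup.1 hg) h
  rwa [sub_sub_cancel] at this

theorem Lead.of (x : X) : Lead (FreeGroup.of x) 1 (coef (.of x)) := by
  rw [Lead, magnusOp_of, add_sub_cancel_left, sub_self]; exact zero_mem _

theorem Lead.mul {g h : FreeGroup X} {n : ℕ} {κ l : List X → ℤ} (hg : Lead g n κ)
    (hh : Lead h n l) : Lead (g * h) n (κ + l) := by
  have e : magnusOp (g * h) - 1 - homogOp n (κ + l) =
      (magnusOp g - 1 - homogOp n κ) * magnusOp h + homogOp n κ * (magnusOp h - 1) +
        (magnusOp h - 1 - homogOp n l) := by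
    rw [magnusOp_mul, homogOp_add]; noncomm_ring
  rw [Lead, e]
  exact add_mem (add_mem (raising_mul (k := 0) le_rfl hg (magnusOp_mem h).1)
    (raising_mul le_rfl (homogOp_mem n κ) (magnusOp_mem h).2)) hh

theorem Lead.inv {g : FreeGroup X} {n : ℕ} {κ : List X → ℤ} (hg : Lead g n κ) :
    Lead g⁻¹ n (-κ) := by
  have e : magnusOp g⁻¹ - 1 - homogOp n (-κ) =
      -((magnusOp g - 1 - homogOp n κ) * magnusOp g⁻¹ + homogOp n κ * (magnusOp g⁻¹ - 1)) := by
    have h1 := magnusOp_mul_inv g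
    have h2 : (magnusOp g - 1 - homogOp n κ) * magnusOp g⁻¹ + homogOp n κ * (magnusOp g⁻¹ - 1) =
        magnusOp g * magnusOp g⁻¹ - magnusOp g⁻¹ - homogOp n κ := by noncomm_ring
    rw [h2, h1, homogOp_neg]; noncomm_ring
  rw [Lead, e]
  exact neg_mem (add_mem (raising_mul (k := 0) le_rfl hg (magnusOp_mem _).1)
    (raising_mul le_rfl (homogOp_mem n κ) (magnusOp_mem _).2))

/-- The commutator of two homogeneous polynomials of degrees `n` and `m`. -/
def polyBracket (n m : ℕ) (κ l : List X → ℤ) : List X → ℤ := fun w =>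
  κ (w.take n) * l (w.drop n) - l (w.take m) * κ (w.drop m)

theorem Lead.comm {g h : FreeGroup X} {n m : ℕ} {κ l : List X → ℤ}
    (hg : Lead g n κ) (hh : Lead h m l) : Lead ⁅g, h⁆ (n + m) (polyBracket n m κ l) := by
  set p := magnusOp g - 1 with hp
  set q := magnusOp h - 1 with hq
  set P := homogOp n κ with hP
  set Q := homogOp m l with hQ
  have e0 : homogOp (n + m) (polyBracket n m κ l) = P * Q - Q * P := by
    rw [hP, hQ, homogOp_mul, homogOp_mul, add_comm m n, ← homogOp_sub]; rfl
  have e : magnusOp ⁅g, h⁆ - 1 - homogOp (n + m) (polyBracket n m κ l) =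
      ((p - P) * q + P * (q - Q) - ((q - Q) * p + Q * (p - P))) * magnusOp (g⁻¹ * h⁻¹) +
        (P * Q - Q * P) * (magnusOp (g⁻¹ * h⁻¹) - 1) := by
    rw [magnusOp_comm_sub_one, ← hp, ← hq, e0]; noncomm_ring
  have mp : p ∈ raising X n := hg.mem
  have mq : q ∈ raising X m := hh.mem
  have mP : P ∈ raising X n := homogOp_mem n κ
  have mQ : Q ∈ raising X m := homogOp_mem m l
  rw [Lead, e]
  refine add_mem (raising_mul (k := 0) le_rfl (sub_mem (add_mem ?_ ?_) (add_mem ?_ ?_))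
    (magnusOp_mem _).1) (raising_mul le_rfl (sub_mem ?_ ?_) (magnusOp_mem _).2)
  · exact raising_mul (by omega) hg mq
  · exact raising_mul (by omega) mP hh
  · exact raising_mul (by omega) hh mp
  · exact raising_mul (by omega) mQ hg
  · exact raising_mul le_rfl mP mQ
  · exact raising_mul (by omega) mQ mP

theorem Lead.evalTree (t : FreeMagma X) :
    Lead (evalTree (FreeGroup.of : X → FreeGroup X) t) (size t) (coef t) := by
  induction t using FreeMagma.rec with
  | of x => exact Lead.of x
  | mul a b iha ihb => rw [size_mul]; exact iha.comm ihb

theorem exists_lead_one (g : FreeGroup X) : ∃ κ, Lead g 1 κ := by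
  induction g using FreeGroup.induction_on with
  | C1 => exact ⟨0, lead_zero_iff.2 (one_mem _)⟩
  | of x => exact ⟨_, Lead.of x⟩
  | inv_of x h => exact ⟨_, (Lead.of x).inv⟩
  | mul g h hg hh =>
    obtain ⟨κ, hκ⟩ := hg
    obtain ⟨l, hl⟩ := hh
    exact ⟨_, hκ.mul hl⟩

/-- By triangularity, at the least foliage occurring in the support only one tree contributes, with
coefficient `1`. -/
theorem lyndon_coef_independent [LinearOrder X] (n : ℕ)
    (e : {t : FreeMagma X // LyndonTree t ∧ size t = n} →₀ ℤ)
    (h : ∀ w : List X, w.length = n →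
      Finsupp.linearCombination ℤ (fun t : {t : FreeMagma X // LyndonTree t ∧ size t = n} =>
        coef t.1) e w = 0) : e = 0 := by
  by_contra hne
  obtain ⟨t, ht, hmin⟩ := Finset.exists_min_image e.support (fun t => word t.1)
    (Finsupp.support_nonempty_iff.2 hne)
  have h1 := h (word t.1) t.2.2
  rw [Finsupp.linearCombination_apply, Finsupp.sum, Finset.sum_apply,
    Finset.sum_eq_single t] at h1
  · rw [Pi.smul_apply, t.2.1.coef_spec.1, smul_eq_mul, mul_one] at h1
    exact Finsupp.mem_support_iff.1 ht h1
  · intro t' ht' hne'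
    have hlt : word t.1 < word t'.1 := lt_of_le_of_ne (hmin t' ht') fun hw =>
      hne' (Subtype.ext (t.2.1.eq_of_word_eq t'.2.1 hw)).symm
    rw [Pi.smul_apply, t'.2.1.coef_spec.2 _ (by rw [t'.2.2]; exact t.2.2) hlt, smul_zero]
  · intro h'; exact absurd ht h'

/-- The exponent vector of an element of a free group. -/
noncomputable def exponents {T : Type u} : FreeGroup T →* Multiplicative (T →₀ ℤ) :=
  FreeGroup.lift fun t => Multiplicative.ofAdd (Finsupp.single t 1)

/-- The map to the abelianization factors through the exponent vector. -/
theorem mem_commutator_of_exponents {T : Type u} {w : FreeGroup T} (hw : exponents w = 1) :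
    w ∈ commutator (FreeGroup T) := by
  let ψ : (T →₀ ℤ) →+ Additive (Abelianization (FreeGroup T)) :=
    Finsupp.liftAddHom fun t =>
      zmultiplesHom _ (Additive.ofMul (Abelianization.of (FreeGroup.of t)))
  have h : (AddMonoidHom.toMultiplicativeLeft ψ).comp exponents = Abelianization.of := by
    ext t
    simp [exponents, ψ]
  have h1 := DFunLike.congr_fun h w
  rw [MonoidHom.comp_apply, hw, map_one] at h1
  rw [← Abelianization.ker_of, MonoidHom.mem_ker, ← h1]

theorem lift_mem_gam_succ {T : Type u} {G : Type u} [Group G] {n : ℕ} (hn : 1 ≤ n) {b : T → G}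
    (hb : ∀ t, b t ∈ gam G n) {w : FreeGroup T} (hw : exponents w = 1) :
    FreeGroup.lift b w ∈ gam G (n + 1) := by
  have hr : (FreeGroup.lift b).range ≤ gam G n := by
    rw [FreeGroup.range_lift_eq_closure, Subgroup.closure_le]
    rintro _ ⟨t, rfl⟩
    exact hb t
  have h : FreeGroup.lift b w ∈ (commutator (FreeGroup T)).map (FreeGroup.lift b) :=
    ⟨w, mem_commutator_of_exponents hw, rfl⟩
  rw [commutator_def, Subgroup.map_commutator, ← MonoidHom.range_eq_map] at h
  exact gam_antitone (by omega) (commutator_gam_le n n (Subgroup.commutator_mono hr hr h))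

theorem Lead.lift {T : Type u} {n : ℕ} {b : T → FreeGroup X} {κ : T → List X → ℤ}
    (hb : ∀ t, Lead (b t) n (κ t)) (w : FreeGroup T) : Lead (FreeGroup.lift b w) n
      (Finsupp.linearCombination ℤ κ (Multiplicative.toAdd (exponents w))) := by
  have ex_of : ∀ t : T, Multiplicative.toAdd (exponents (FreeGroup.of t)) = Finsupp.single t 1 :=
    fun t => by rw [exponents, FreeGroup.lift_apply_of]; rfl
  induction w using FreeGroup.induction_on with
  | C1 =>
    rw [map_one, map_one, toAdd_one, map_zero]
    exact lead_zero_iff.2 (one_mem _)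
  | of t =>
    rw [ex_of, FreeGroup.lift_apply_of, Finsupp.linearCombination_single, one_smul]
    exact hb t
  | inv_of t h =>
    rw [map_inv, map_inv, toAdd_inv, map_neg]
    exact h.inv
  | mul v w hv hw =>
    rw [map_mul, map_mul, toAdd_mul, map_add]
    exact hv.mul hw

/-- Modulo `gam (n + 1)`, `g` is a product of Lyndon commutators, and its degree `n` part is the
corresponding integral combination of their Lie polynomials. This part vanishes, so by independence
all exponents are zero and the product lies in `gam (n + 1)`. -/
theorem mem_gam_succ_of_mem_dimSubgroup [LinearOrder X] [WellFoundedLT X] (n : ℕ) (hn : 1 ≤ n)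
    {g : FreeGroup X} (hg : g ∈ gam (FreeGroup X) n) (hd : g ∈ dimSubgroup X (n + 1)) :
    g ∈ gam (FreeGroup X) (n + 1) := by
  have h1 := gam_le_closure_lyndonComms (FreeGroup.of : X → FreeGroup X)
    (FreeGroup.closure_range_of X) n hn hg
  obtain ⟨c, hc, z, hz, rfl⟩ := Subgroup.mem_sup_of_normal_right.1 h1
  refine mul_mem ?_ hz
  have hcd : c ∈ dimSubgroup X (n + 1) := by
    have := mul_mem hd (inv_mem (gam_le_dimSubgroup (n + 1) (by omega) hz))
    rwa [mul_inv_cancel_right] at this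
  have hcomms : lyndonComms (FreeGroup.of : X → FreeGroup X) n =
      Set.range fun t : {t : FreeMagma X // LyndonTree t ∧ size t = n} =>
        evalTree FreeGroup.of t.1 := by
    ext g
    constructor
    · rintro ⟨t, ht, hs, rfl⟩; exact ⟨⟨t, ht, hs⟩, rfl⟩
    · rintro ⟨t, rfl⟩; exact ⟨t.1, t.2.1, t.2.2, rfl⟩
  rw [hcomms, ← FreeGroup.range_lift_eq_closure] at hc
  obtain ⟨w, rfl⟩ := hc
  have hb : ∀ t : {t : FreeMagma X // LyndonTree t ∧ size t = n},
      Lead (evalTree FreeGroup.of t.1) n (coef t.1) := fun t => by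
    have := Lead.evalTree t.1
    rwa [t.2.2] at this
  have hzero : Multiplicative.toAdd (exponents w) = 0 :=
    lyndon_coef_independent n _ fun v hv => (Lead.lift hb w).eq_zero hcd hv
  refine lift_mem_gam_succ hn (fun t => ?_) hzero
  have := evalTree_mem (FreeGroup.of : X → FreeGroup X) t.1
  rwa [t.2.2] at this

/-- Magnus' theorem: the lower central series of a free group consists of the dimension
subgroups. -/
theorem gam_eq_dimSubgroup (n : ℕ) (hn : 1 ≤ n) : gam (FreeGroup X) n = dimSubgroup X n := by
  -- The statement involves no order on the alphabet, so any well-order may be chosen; no finiteness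
  -- of `X` is needed.
  obtain ⟨_, _⟩ := exists_wellFoundedLT X
  refine le_antisymm (gam_le_dimSubgroup n hn) ?_
  induction n, hn using Nat.le_induction with
  | base => exact fun g _ => mem_gam_one g
  | succ n hn ih =>
    intro g hg
    exact mem_gam_succ_of_mem_dimSubgroup n hn
      (ih (raising_antitone (Nat.le_succ n) (mem_dimSubgroup.1 hg))) hg

/-- With `p = g - 1` one has `g² - 1 = 2p + p²`, where `p²` has order at least `2n ≥ n + 1`; integer
coefficients allow division by `2`. -/
theorem mem_gam_succ_of_sq_mem {n : ℕ} (hn : 1 ≤ n) {g : FreeGroup X}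
    (hg : g ∈ gam (FreeGroup X) n) (h2 : g ^ 2 ∈ gam (FreeGroup X) (n + 1)) :
    g ∈ gam (FreeGroup X) (n + 1) := by
  rw [gam_eq_dimSubgroup _ (by omega)] at *
  rw [mem_dimSubgroup] at *
  set p := magnusOp g - 1 with hp
  have e : magnusOp (g ^ 2) - 1 = p + p + p * p := by
    rw [pow_two, magnusOp_mul, hp]; noncomm_ring
  have h3 : p + p ∈ raising X (n + 1) := by
    have := sub_mem h2 (raising_mul (n := n + 1) (by omega) hg hg)
    rwa [e, add_sub_cancel_right] at this
  intro m f hf w hw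
  have h4 := h3 m f hf w hw
  rw [LinearMap.add_apply, Pi.add_apply] at h4
  omega

end Magnus
end FreeNilp

namespace FreeNilp

/-! ### Free nilpotent groups, their universal property, and `IA(N)`. -/

section FreeNilpotent

open scoped commutatorElement

theorem gam_map_of_surjective {G H : Type u} [Group G] [Group H] (f : G →* H)
    (hf : Function.Surjective f) (n : ℕ) : (gam G n).map f = gam H n := by
  unfold gam
  rw [Subgroup.map_lowerCentralSeries, Subgroup.map_top_of_surjective f hf]

variable {N : Type u} [Group N] {s : ℕ} {B : Set N}

/-- The presentation of a free nilpotent group by a free group on its basis. -/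
abbrev pres (B : Set N) : FreeGroup B →* N := FreeGroup.lift ((↑) : B → N)

theorem IsBasis.ker_eq_gam (hB : IsBasis s B) : (pres B).ker = gam (FreeGroup B) (s + 1) :=
  hB.ker_eq

/-- The kernel of the presentation is contained in `gam n` for these `n`; this transfers results on
free groups to `N`. -/
theorem IsBasis.pres_mem_iff (hB : IsBasis s B) {n : ℕ} (hn : n ≤ s + 1) (g : FreeGroup B) :
    pres B g ∈ gam N n ↔ g ∈ gam (FreeGroup B) n := by
  rw [← gam_map_of_surjective (pres B) hB.surjective n]
  have : pres B g ∈ (gam (FreeGroup B) n).map (pres B) ↔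
      g ∈ ((gam (FreeGroup B) n).map (pres B)).comap (pres B) := Iff.rfl
  rw [this, Subgroup.comap_map_eq, hB.ker_eq_gam, sup_eq_left.2 (gam_antitone hn)]

theorem IsBasis.gam_eq_bot (hB : IsBasis s B) : gam N (s + 1) = ⊥ := by
  rw [← gam_map_of_surjective (pres B) hB.surjective, ← hB.ker_eq_gam, Subgroup.map_eq_bot_iff]

theorem IsBasis.eq_of_cong (hB : IsBasis s B) {x y : N} (h : Cong (s + 1) x y) : x = y := by
  rw [cong_iff_mul_inv, hB.gam_eq_bot, Subgroup.mem_bot] at h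
  exact mul_inv_eq_one.1 h

theorem IsBasis.exists_hom (hB : IsBasis s B) {H : Type u} [Group H] (hH : gam H (s + 1) = ⊥)
    (f : B → H) : ∃ φ : N →* H, ∀ b : B, φ b = f b := by
  have hker : (pres B).ker ≤ (FreeGroup.lift f).ker := by
    rw [hB.ker_eq_gam]
    intro g hg
    have : FreeGroup.lift f g ∈ gam H (s + 1) := map_mem_gam _ _ hg
    rwa [hH, Subgroup.mem_bot] at this
  refine ⟨(pres B).liftOfSurjective hB.surjective ⟨FreeGroup.lift f, hker⟩, fun b => ?_⟩
  have := (pres B).liftOfRightInverse_comp_apply (Function.surjInv hB.surjective)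
    (Function.rightInverse_surjInv hB.surjective) ⟨FreeGroup.lift f, hker⟩ (FreeGroup.of b)
  simpa using this

theorem IsBasis.hom_ext (hB : IsBasis s B) {H : Type u} [Group H] {φ ψ : N →* H}
    (h : ∀ b ∈ B, φ b = ψ b) : φ = ψ := by
  have h1 : φ.comp (pres B) = ψ.comp (pres B) := by
    ext b
    simpa using h b b.2
  ext x
  obtain ⟨g, rfl⟩ := hB.surjective x
  exact DFunLike.congr_fun h1 g

theorem IsBasis.mem_gam_of_sq_mem (hB : IsBasis s B) {n : ℕ} (hn : 1 ≤ n) (hns : n ≤ s) {x : N}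
    (hx : x ∈ gam N n) (h2 : x ^ 2 ∈ gam N (n + 1)) : x ∈ gam N (n + 1) := by
  obtain ⟨g, rfl⟩ := hB.surjective x
  rw [← map_pow] at h2
  rw [hB.pres_mem_iff (by omega)] at *
  exact mem_gam_succ_of_sq_mem hn hx h2

theorem cong_of_cong_two {G : Type u} [Group G] (f : G →* G) (hf : ∀ x, Cong 2 (f x) x) {k : ℕ}
    (hk : 1 ≤ k) {x : G} (hx : x ∈ gam G k) : Cong (k + 1) (f x) x := by
  have := cong_zpow_of_cong_two f 1 (fun x => by simpa using hf x) k hk x hx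
  simpa using this

/-- Such an `f` is the identity on every factor of the series. A kernel element therefore sinks
through all the terms, and the range absorbs the terms one by one from the bottom up. -/
theorem IsBasis.bijective_of_cong_two (hB : IsBasis s B) (f : N →* N)
    (hf : ∀ x, Cong 2 (f x) x) : Function.Bijective f := by
  constructor
  · rw [injective_iff_map_eq_one]
    intro x hx
    have : ∀ k, x ∈ gam N (k + 1) := by
      intro k
      induction k with
      | zero => exact mem_gam_one x
      | succ k ih =>
        have := cong_of_cong_two f hf (by omega) ih
        rw [hx] at this
        exact cong_one_iff.1 this.symm
    have h := this s
    rwa [hB.gam_eq_bot, Subgroup.mem_bot] at h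
  · have : ∀ j, j ≤ s → gam N (s + 1 - j) ≤ f.range := by
      intro j
      induction j with
      | zero => intro _; rw [Nat.sub_zero, hB.gam_eq_bot]; exact bot_le
      | succ j ih =>
        intro hj x hx
        have h1 := cong_of_cong_two f hf (by omega) hx
        rw [show s + 1 - (j + 1) + 1 = s + 1 - j by omega] at h1
        have h2 := ih (by omega) (cong_iff_mul_inv.1 h1)
        have h3 := mul_mem (inv_mem h2) (⟨x, rfl⟩ : f x ∈ f.range)
        simpa using h3
    intro x
    have h := this s le_rfl
    rw [Nat.add_sub_cancel_left] at h
    exact h (mem_gam_one x)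

theorem cong_two_iff {G : Type u} [Group G] {x y : G} :
    Cong 2 x y ↔ Abelianization.of x = Abelianization.of y := Iff.rfl

theorem mem_IA_iff {f : MulAut N} : f ∈ IA N ↔ ∀ x, Cong 2 (f x) x := by
  unfold IA
  rw [MonoidHom.mem_ker]
  constructor
  · intro h x
    have h1 := DFunLike.congr_fun h (Abelianization.of x)
    exact h1
  · intro h
    ext z
    obtain ⟨x, rfl⟩ := QuotientGroup.mk_surjective z
    exact h x

/-- The action of `θ` on the abelianization is inversion. -/
def IsNegOnAb {G : Type u} [Group G] (θ : MulAut G) : Prop := ∀ x, Cong 2 (θ x) x⁻¹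

theorem IsSymmetry.isNegOnAb {θ : MulAut N} (h : IsSymmetry s θ) : IsNegOnAb θ := by
  obtain ⟨B, hB, h⟩ := h
  have h1 : (Abelianization.of.comp θ.toMonoidHom : N →* Abelianization N) =
      (Abelianization.of)⁻¹ := by
    refine hB.hom_ext fun b hb => ?_
    change Abelianization.of (θ b) = (Abelianization.of b)⁻¹
    rw [h b hb, map_inv]
  intro x
  rw [cong_two_iff, map_inv]
  exact DFunLike.congr_fun h1 x

theorem IsBasis.exists_symmetry (hB : IsBasis s B) :
    ∃ y : MulAut N, (∀ b ∈ B, y b = b⁻¹) ∧ y * y = 1 := by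
  obtain ⟨φ, hφ⟩ := hB.exists_hom hB.gam_eq_bot fun b => (b : N)⁻¹
  have h2 : φ.comp φ = MonoidHom.id N := by
    refine hB.hom_ext fun b hb => ?_
    change φ (φ b) = b
    rw [hφ ⟨b, hb⟩, map_inv, hφ ⟨b, hb⟩, inv_inv]
  refine ⟨MonoidHom.toMulEquiv φ φ h2 h2, fun b hb => hφ ⟨b, hb⟩, ?_⟩
  ext x
  exact DFunLike.congr_fun h2 x

/-- All symmetries act on the abelianization as `-1`, so the symmetry of any one basis can serve as
the representative of the coset. -/
theorem isSymmetryModIA_iff (hN : IsFreeNilpotent s N) (θ : MulAut N) :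
    IsSymmetryModIA s θ ↔ IsNegOnAb θ := by
  constructor
  · rintro ⟨y, hy, h⟩ x
    rw [mem_IA_iff] at h
    have h1 := (h x).map y.toMonoidHom
    have h2 : Cong 2 (θ x) (y x) := by
      simpa using h1
    exact h2.trans (hy.isNegOnAb x)
  · intro h
    obtain ⟨B, hB⟩ := hN
    obtain ⟨y, hy, hyy⟩ := hB.exists_symmetry
    have hs : IsSymmetry s y := ⟨B, hB, hy⟩
    refine ⟨y, hs, mem_IA_iff.2 fun x => ?_⟩
    have hyinv : y⁻¹ = y := inv_eq_of_mul_eq_one_left hyy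
    rw [hyinv]
    have h1 := (h x).map y.toMonoidHom
    have h2 := (hs.isNegOnAb x⁻¹)
    rw [inv_inv] at h2
    exact h1.trans h2

/-- There are no involutions in `IA(N)`. -/
theorem IsBasis.eq_one_of_sq_eq_one (hB : IsBasis s B) {θ : MulAut N} (h : ∀ x, Cong 2 (θ x) x)
    (h2 : θ * θ = 1) : θ = 1 := by
  have key : ∀ k, k ≤ s → ∀ x, Cong (k + 1) (θ x) x := by
    intro k
    induction k with
    | zero => intro _ x; exact cong_iff_mul_inv.2 (mem_gam_one _)
    | succ k ih =>
      intro hk x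
      rcases Nat.eq_zero_or_pos k with rfl | hk0
      · exact h x
      have hd := cong_iff_mul_inv.1 (ih (by omega) x)
      set d := θ x * x⁻¹ with hd'
      -- Modulo the next term `θ` fixes the displacement `d`, whereas `θ² = 1` gives `θ d = d⁻¹`.
      -- Hence `d²` lies in the next term, and so does `d` by the absence of 2-torsion.
      have h3 : Cong (k + 1 + 1) (θ d) d := cong_of_cong_two θ.toMonoidHom h (by omega) hd
      have h4 : θ (θ x) = x := DFunLike.congr_fun h2 x
      have h5 : θ d = d⁻¹ := by
        rw [hd', map_mul, map_inv, h4, mul_inv_rev, inv_inv]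
      have h6 : d ^ 2 ∈ gam N (k + 1 + 1) := by
        rw [h5] at h3
        have := cong_iff_mul_inv.1 h3.symm
        rwa [inv_inv, ← pow_two] at this
      exact cong_iff_mul_inv.2 (hB.mem_gam_of_sq_mem (by omega) hk hd h6)
  ext x
  exact hB.eq_of_cong (key s le_rfl x)

end FreeNilpotent
end FreeNilp

namespace FreeNilp

/-! ### The filtration of `Aut(N)` by depth of action, and the forward direction of the criterion.
-/

section Filtration

open scoped commutatorElement

variable {G : Type u} [Group G]

/-- The automorphisms that act trivially modulo `gam G (k + 1)`. -/
def ActsTrivially (k : ℕ) (σ : MulAut G) : Prop := ∀ x, Cong (k + 1) (σ x) x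

theorem actsTrivially_zero (σ : MulAut G) : ActsTrivially 0 σ := fun _ =>
  cong_iff_mul_inv.2 (mem_gam_one _)

theorem ActsTrivially.mem {k : ℕ} {σ : MulAut G} (h : ActsTrivially k σ) (x : G) :
    σ x * x⁻¹ ∈ gam G (k + 1) := cong_iff_mul_inv.1 (h x)

/-- The displacement homomorphism of an automorphism that acts trivially modulo
`gam G (k + 1)`. -/
def ActsTrivially.delta {k : ℕ} {σ : MulAut G} (h : ActsTrivially k σ) :
    G →* G ⧸ gam G (k + 2) where
  toFun x := ((σ x * x⁻¹ : G) : G ⧸ gam G (k + 2))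
  map_one' := by simp
  map_mul' x y := by
    have e : σ (x * y) * (x * y)⁻¹ = σ x * x⁻¹ * (x * (σ y * y⁻¹) * x⁻¹) := by
      rw [map_mul]; group
    rw [e, QuotientGroup.mk_mul]
    congr 1
    exact cong_conj (n := k + 2) le_rfl x (h.mem y)

/-- The displacement homomorphism takes central values, so it kills commutators. -/
theorem ActsTrivially.displacement_congr {k : ℕ} {σ : MulAut G} (h : ActsTrivially k σ) {x y : G}
    (hxy : Cong 2 x y) : Cong (k + 2) (σ x * x⁻¹) (σ y * y⁻¹) := by
  have hle : gam G 2 ≤ h.delta.ker := by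
    rw [gam_succ 1 le_rfl, Subgroup.commutator_le]
    intro a _ b _
    rw [MonoidHom.mem_ker, map_commutatorElement, commutatorElement_eq_one_iff_mul_comm]
    exact cong_mul_comm (n := k + 2) (i := k + 1) (j := 1) (by omega) (h.mem a) (mem_gam_one _)
  have h1 := hle (cong_iff_mul_inv.1 hxy)
  rw [MonoidHom.mem_ker, map_mul, map_inv, mul_inv_eq_one] at h1
  exact h1

theorem IsNegOnAb.cong_zpow {θ : MulAut G} (h : IsNegOnAb θ) {k : ℕ} (hk : 1 ≤ k) {x : G}
    (hx : x ∈ gam G k) : Cong (k + 1) (θ x) (x ^ ((-1 : ℤ) ^ k)) :=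
  cong_zpow_of_cong_two θ.toMonoidHom (-1) (fun x => by simpa using h x) k hk x hx

theorem IsNegOnAb.symm_cong {θ : MulAut G} (h : IsNegOnAb θ) (x : G) : Cong 2 (θ⁻¹ x) x⁻¹ := by
  have h1 := h (θ⁻¹ x)
  rw [MulAut.apply_inv_self] at h1
  have h2 := h1.inv
  rw [inv_inv] at h2
  exact h2.symm

/-- Conjugation with `θ` multiplies the displacement by `(-1) ^ k`. -/
theorem ActsTrivially.conj_displacement {k : ℕ} {σ θ : MulAut G} (h : ActsTrivially k σ)
    (hθ : IsNegOnAb θ) (x : G) :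
    Cong (k + 2) ((θ * σ * θ⁻¹) x) ((σ x * x⁻¹) ^ ((-1 : ℤ) ^ k) * x) := by
  set d : G → G := fun x => σ x * x⁻¹ with hd
  have e : (θ * σ * θ⁻¹) x = θ (d (θ⁻¹ x)) * x := by
    simp only [hd, MulAut.mul_apply, map_mul, map_inv, MulAut.apply_inv_self]
    group
  rw [e]
  refine Cong.mul ?_ (Cong.refl x)
  have hdx : d x ∈ gam G (k + 1) := h.mem x
  -- Two signs combine: `θ⁻¹` inverts the argument of the displacement, and `θ` contributes `(-1) ^
  -- (k + 1)` on its values in `gam G (k + 1)`.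
  have h1 : Cong (k + 2) (d (θ⁻¹ x)) (d x)⁻¹ := by
    have h2 := h.displacement_congr (hθ.symm_cong x)
    have h3 : h.delta x⁻¹ = (h.delta x)⁻¹ := map_inv _ _
    exact h2.trans h3
  refine (h1.map θ.toMonoidHom).trans ?_
  have h4 : Cong (k + 2) (θ (d x)⁻¹) ((d x)⁻¹ ^ ((-1 : ℤ) ^ (k + 1))) :=
    hθ.cong_zpow (by omega) (inv_mem hdx)
  have h5 : (d x)⁻¹ ^ ((-1 : ℤ) ^ (k + 1)) = d x ^ ((-1 : ℤ) ^ k) := by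
    rw [inv_zpow', pow_succ, mul_neg_one, neg_neg]
  rw [h5] at h4
  exact h4

/-- For even `k` conjugation by `θ` preserves displacements, so multiplying by `σ⁻¹` cancels them.
For odd `k` it inverts them, and `σ` itself is needed, as in `conj_mul`. This is the case
distinction in `sigmaWord`. -/
theorem ActsTrivially.conj_mul_inv {k : ℕ} (hk : Even k) {σ θ : MulAut G}
    (h : ActsTrivially k σ) (hθ : IsNegOnAb θ) : ActsTrivially (k + 1) (θ * σ * θ⁻¹ * σ⁻¹) := by
  intro x
  have h1 := h.conj_displacement hθ (σ⁻¹ x)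
  rw [hk.neg_one_pow, zpow_one, MulAut.apply_inv_self, inv_mul_cancel_right] at h1
  exact h1

theorem ActsTrivially.conj_mul {k : ℕ} (hk : ¬ Even k) {σ θ : MulAut G}
    (h : ActsTrivially k σ) (hθ : IsNegOnAb θ) : ActsTrivially (k + 1) (θ * σ * θ⁻¹ * σ) := by
  intro x
  have hk' : Odd k := Nat.not_even_iff_odd.1 hk
  have hk1 : 1 ≤ k := hk'.pos
  have h1 := h.conj_displacement hθ (σ x)
  rw [hk'.neg_one_pow, zpow_neg_one] at h1
  have h2 : Cong (k + 2) (σ (σ x) * (σ x)⁻¹) (σ x * x⁻¹) :=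
    h.displacement_congr ((h x).mono (by omega))
  have h3 := h2.inv.mul (Cong.refl (n := k + 2) (σ x))
  have h4 : (σ x * x⁻¹)⁻¹ * σ x = x := by group
  rw [h4] at h3
  exact h1.trans h3

theorem IsNegOnAb.conj {θ : MulAut G} (h : IsNegOnAb θ) (τ : MulAut G) :
    IsNegOnAb (τ * θ * τ⁻¹) := by
  intro x
  have h1 := (h (τ⁻¹ x)).map τ.toMonoidHom
  have h2 : τ (τ⁻¹ x)⁻¹ = x⁻¹ := by rw [map_inv, MulAut.apply_inv_self]
  have h3 : Cong 2 (τ (θ (τ⁻¹ x))) (τ (τ⁻¹ x)⁻¹) := h1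
  rw [h2] at h3
  exact h3

theorem actsTrivially_sigmaWord (σ : MulAut G) (m : ℕ) : ∀ φ : Fin m → MulAut G,
    (∀ i, IsNegOnAb (φ i)) → (∀ i, φ i * φ i = 1) → ActsTrivially m (sigmaWord σ m φ) := by
  induction m with
  | zero => intro _ _ _; exact actsTrivially_zero _
  | succ m ih =>
    intro φ hφ hφ2
    have h := ih (Fin.init φ) (fun i => hφ _) (fun i => hφ2 _)
    have hinv : (φ (Fin.last m))⁻¹ = φ (Fin.last m) := inv_eq_of_mul_eq_one_left (hφ2 _)
    rw [sigmaWord]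
    split_ifs with hm
    · have := h.conj_mul_inv hm (hφ (Fin.last m))
      rwa [hinv] at this
    · have := h.conj_mul hm (hφ (Fin.last m))
      rwa [hinv] at this

theorem IsBasis.eq_one_of_actsTrivially {s : ℕ} {B : Set G} (hB : IsBasis s B) {σ : MulAut G}
    (h : ActsTrivially s σ) : σ = 1 := by
  ext x
  exact hB.eq_of_cong (h x)

theorem sigmaWord_eq_one_of_isNegOnAb {s : ℕ} (hN : IsFreeNilpotent s G) {θ : MulAut G}
    (h : IsNegOnAb θ) (h2 : θ * θ = 1) (σ : MulAut G) (θs : Fin s → MulAut G)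
    (hθs : ∀ i, IsConj θ (θs i)) : sigmaWord σ s θs = 1 := by
  obtain ⟨B, hB⟩ := hN
  refine hB.eq_one_of_actsTrivially (actsTrivially_sigmaWord σ s θs (fun i => ?_) fun i => ?_)
  · obtain ⟨τ, hτ⟩ := isConj_iff.1 (hθs i)
    rw [← hτ]; exact h.conj τ
  · obtain ⟨τ, hτ⟩ := isConj_iff.1 (hθs i)
    rw [← hτ, conj_mul, h2]; simp

theorem ActsTrivially.cong_on_gam {k : ℕ} {σ : MulAut G} (h : ActsTrivially k σ) {x : G}
    (hx : x ∈ gam G 2) : Cong (k + 2) (σ x) x := by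
  have h1 := h.displacement_congr (cong_one_iff.2 hx)
  rw [map_one, inv_one, mul_one] at h1
  rw [cong_iff_mul_inv]
  exact cong_one_iff.1 h1

/-- The commutator with an element of `IA` goes one step down. -/
theorem ActsTrivially.comm {k : ℕ} {σ τ : MulAut G} (hσ : ActsTrivially k σ)
    (hτ : ActsTrivially 1 τ) : ActsTrivially (k + 1) ⁅σ, τ⁆ := by
  have key : ∀ x, Cong (k + 2) (σ (τ x)) (τ (σ x)) := by
    intro x
    have e1 : σ (τ x) = σ (τ x * x⁻¹) * ((σ x * x⁻¹) * x) := by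
      rw [inv_mul_cancel_right, ← map_mul, inv_mul_cancel_right]
    have e2 : τ (σ x) = τ (σ x * x⁻¹) * ((τ x * x⁻¹) * x) := by
      rw [inv_mul_cancel_right, ← map_mul, inv_mul_cancel_right]
    have h1 := hσ.cong_on_gam (hτ.mem x)
    have h2 : Cong (k + 2) (τ (σ x * x⁻¹)) (σ x * x⁻¹) :=
      cong_of_cong_two τ.toMonoidHom hτ (by omega) (hσ.mem x)
    rw [e1, e2]
    refine (h1.mul (Cong.refl _)).trans (Cong.trans ?_ (h2.mul (Cong.refl _)).symm)
    rw [← mul_assoc (τ x * x⁻¹), ← mul_assoc (σ x * x⁻¹)]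
    exact (cong_mul_comm (n := k + 2) (i := 1 + 1) (j := k + 1) (by omega) (hτ.mem x)
      (hσ.mem x)).mul (Cong.refl x)
  intro x
  have h := key ((τ * σ)⁻¹ x)
  have e1 : σ (τ ((τ * σ)⁻¹ x)) = ⁅σ, τ⁆ x := by
    rw [commutatorElement_def, mul_inv_rev]; rfl
  have e2 : τ (σ ((τ * σ)⁻¹ x)) = x := MulAut.apply_inv_self _ (τ * σ) x
  rw [e1, e2] at h
  exact h

end Filtration

/-! ### The action on the abelianization and lifting from it. -/

section Linear

variable {N : Type u} [Group N] {s : ℕ} {B : Set N}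

/-- The projection to the abelianization, written additively. -/
def ab (x : N) : Additive (Abelianization N) := Additive.ofMul (Abelianization.of x)

theorem ab_mul (x y : N) : ab (x * y) = ab x + ab y := rfl

theorem ab_inv (x : N) : ab x⁻¹ = -ab x := rfl

theorem ab_surjective : Function.Surjective (ab : N → Additive (Abelianization N)) :=
  QuotientGroup.mk_surjective

theorem ab_eq_iff {x y : N} : ab x = ab y ↔ Cong 2 x y := Iff.rfl

theorem IsBasis.free (hs : 1 ≤ s) (hB : IsBasis s B) :
    Module.Free ℤ (Additive (Abelianization N)) := by
  have hbij : Function.Bijective (Abelianization.map (pres B)) := by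
    constructor
    · rw [injective_iff_map_eq_one]
      intro z hz
      obtain ⟨g, rfl⟩ := QuotientGroup.mk_surjective z
      have h1 : Abelianization.of (pres B g) = 1 := hz
      rw [← MonoidHom.mem_ker, Abelianization.ker_of, ← gam_two,
        hB.pres_mem_iff (by omega), gam_two, ← Abelianization.ker_of] at h1
      exact h1
    · intro z
      obtain ⟨x, rfl⟩ := QuotientGroup.mk_surjective z
      obtain ⟨g, rfl⟩ := hB.surjective x
      exact ⟨Abelianization.of g, rfl⟩
  let e : FreeAbelianGroup B ≃+ Additive (Abelianization N) :=
    MulEquiv.toAdditive (MulEquiv.ofBijective _ hbij)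
  exact Module.Free.of_equiv e.toIntLinearEquiv

theorem linear_eq_of_ab {u v : Module.End ℤ (Additive (Abelianization N))}
    (h : ∀ x, u (ab x) = v (ab x)) : u = v := by
  ext z
  obtain ⟨x, rfl⟩ := ab_surjective z
  exact h x

/-- The linear map induced on the abelianization. -/
def abMap (f : N →* N) : Module.End ℤ (Additive (Abelianization N)) :=
  (MonoidHom.toAdditive (Abelianization.map f)).toIntLinearMap

theorem abMap_apply (f : N →* N) (x : N) : abMap f (ab x) = ab (f x) := rfl

/-- The action of the automorphisms on the abelianization. -/
def abAction : MulAut N →* Module.End ℤ (Additive (Abelianization N)) where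
  toFun σ := abMap σ.toMonoidHom
  map_one' := linear_eq_of_ab fun _ => rfl
  map_mul' _ _ := linear_eq_of_ab fun _ => rfl

theorem IsBasis.exists_lift (hB : IsBasis s B)
    (u : Module.End ℤ (Additive (Abelianization N))) : ∃ f : N →* N, abMap f = u := by
  choose c hc using fun b : B => ab_surjective (u (ab (b : N)))
  obtain ⟨φ, hφ⟩ := hB.exists_hom hB.gam_eq_bot c
  refine ⟨φ, linear_eq_of_ab fun x => ?_⟩
  have h : (Abelianization.of.comp φ : N →* Abelianization N) =
      (AddMonoidHom.toMultiplicative u.toAddMonoidHom).comp Abelianization.of := by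
    refine hB.hom_ext fun b hb => ?_
    have := hc ⟨b, hb⟩
    rw [← hφ] at this
    exact this
  exact DFunLike.congr_fun h x

/-- Lifts of `u` and `v` to endomorphisms of `N` have composites inducing the identity on the
abelianization; these are bijective, hence so is the lift of `u`. -/
theorem IsBasis.exists_aut (hB : IsBasis s B)
    {u v : Module.End ℤ (Additive (Abelianization N))} (huv : u * v = 1) (hvu : v * u = 1) :
    ∃ σ : MulAut N, abAction σ = u := by
  obtain ⟨f, hf⟩ := hB.exists_lift u
  obtain ⟨g, hg⟩ := hB.exists_lift v
  have h1 : Function.Bijective (f.comp g) := hB.bijective_of_cong_two _ fun x => by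
    rw [← ab_eq_iff, ← abMap_apply]
    change abMap f (abMap g (ab x)) = ab x
    rw [hf, hg]
    exact LinearMap.congr_fun huv (ab x)
  have h2 : Function.Bijective (g.comp f) := hB.bijective_of_cong_two _ fun x => by
    rw [← ab_eq_iff, ← abMap_apply]
    change abMap g (abMap f (ab x)) = ab x
    rw [hf, hg]
    exact LinearMap.congr_fun hvu (ab x)
  have hbij : Function.Bijective f :=
    ⟨Function.Injective.of_comp (f := g) h2.1, Function.Surjective.of_comp (g := g) h1.2⟩
  exact ⟨MulEquiv.ofBijective f hbij, by rw [← hf]; exact linear_eq_of_ab fun _ => rfl⟩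

theorem isNegOnAb_iff {θ : MulAut N} : IsNegOnAb θ ↔ abAction θ = -1 := by
  constructor
  · exact fun h => linear_eq_of_ab h
  · exact fun h x => LinearMap.congr_fun h (ab x)

theorem cong_two_iff_abAction {θ : MulAut N} : (∀ x, Cong 2 (θ x) x) ↔ abAction θ = 1 := by
  constructor
  · exact fun h => linear_eq_of_ab h
  · exact fun h x => LinearMap.congr_fun h (ab x)

end Linear
end FreeNilp

namespace FreeNilp

/-! ### Involutions of free abelian groups and conjugation by unipotents. -/

section Linear

variable {A : Type u} [AddCommGroup A]

/-- The conjugates of `α` by the unipotents `1 + n` send `σ` to `τ` or to `-τ`. -/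
def TwistsTo (α σ τ : Module.End ℤ A) : Prop :=
  ∀ n : Module.End ℤ A, n * n = 0 →
    (1 + n) * α * (1 - n) * σ * ((1 + n) * α * (1 - n)) = τ ∨
    (1 + n) * α * (1 - n) * σ * ((1 + n) * α * (1 - n)) = -τ

theorem TwistsTo.neg {α σ τ : Module.End ℤ A} (h : TwistsTo α σ τ) : TwistsTo (-α) σ τ := by
  intro n hn
  have e : (1 + n) * -α * (1 - n) * σ * ((1 + n) * -α * (1 - n)) =
      (1 + n) * α * (1 - n) * σ * ((1 + n) * α * (1 - n)) := by
    simp only [mul_neg, neg_mul, neg_neg]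
  rw [e]
  exact h n hn

variable [Module.Free ℤ A]

theorem eq_zero_of_zsmul {k : ℤ} (hk : k ≠ 0) {x : A} (h : k • x = 0) : x = 0 := by
  let b := Module.Free.chooseBasis ℤ A
  refine b.repr.injective (Finsupp.ext fun i => ?_)
  have h1 : k • b.repr x = 0 := by rw [← map_smul, h, map_zero]
  have h2 := DFunLike.congr_fun h1 i
  simpa [hk] using h2

theorem end_eq_zero_of_zsmul {k : ℤ} (hk : k ≠ 0) {u : Module.End ℤ A} (h : k • u = 0) :
    u = 0 := by
  ext x
  exact eq_zero_of_zsmul hk (LinearMap.congr_fun h x)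

theorem exists_functional {x : A} (hx : x ≠ 0) : ∃ f : A →ₗ[ℤ] ℤ, f x ≠ 0 := by
  by_contra! h
  let b := Module.Free.chooseBasis ℤ A
  exact hx (b.ext_elem fun i => by simpa using h (b.coord i))

/-- Here `(1 + n)α(1 - n) = α - 2n`, so the twisted product is `ασα - 2(nσα + ασn) + 4nσn`. For `n`
and `-n` it takes the same value, which kills the middle term, or opposite values, which gives `ασα
+ 4nσn = 0`. If the latter holds for both `n` and `2n`, then `3ασα = 0` and `σ = 0`. -/
theorem TwistsTo.anticomm {α σ τ : Module.End ℤ A} (h : TwistsTo α σ τ) (hα : α * α = 1)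
    {n : Module.End ℤ A} (h1 : α * n = n) (h2 : n * α = -n) :
    n * σ * α + α * σ * n = 0 ∨ σ = 0 := by
  have expand : ∀ m : Module.End ℤ A, α * m = m → m * α = -m → m * m = 0 ∧
      (1 + m) * α * (1 - m) * σ * ((1 + m) * α * (1 - m)) =
        α * σ * α - (2 : ℤ) • (m * σ * α + α * σ * m) + (4 : ℤ) • (m * σ * m) := by
    intro m h1 h2
    have h3 : m * m = 0 := by
      have : m * m = -(m * m) := by
        calc m * m = m * (α * m) := by rw [h1]
          _ = m * α * m := by rw [mul_assoc]
          _ = -(m * m) := by rw [h2, neg_mul]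
      refine end_eq_zero_of_zsmul (k := 2) (by norm_num) ?_
      rw [two_smul]
      nth_rewrite 1 [this]
      exact neg_add_cancel _
    have h4 : (1 + m) * α * (1 - m) = α - (2 : ℤ) • m := by
      have : (1 + m) * α * (1 - m) = α + m * α - α * m - m * α * m := by noncomm_ring
      rw [this, h1, h2, neg_mul, h3, two_smul]; abel
    refine ⟨h3, ?_⟩
    rw [h4]; noncomm_ring
  have pm : ∀ m : Module.End ℤ A, α * m = m → m * α = -m →
      m * σ * α + α * σ * m = 0 ∨ α * σ * α + (4 : ℤ) • (m * σ * m) = 0 := by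
    intro m h1 h2
    obtain ⟨e1, e2⟩ := expand m h1 h2
    obtain ⟨e3, e4⟩ := expand (-m) (by rw [mul_neg, h1]) (by rw [neg_mul, h2])
    have t1 := h m e1
    have t2 := h (-m) e3
    rw [e2] at t1
    rw [e4] at t2
    have same : ∀ x : Module.End ℤ A,
        α * σ * α - (2 : ℤ) • (m * σ * α + α * σ * m) + (4 : ℤ) • (m * σ * m) = x →
        α * σ * α - (2 : ℤ) • (-m * σ * α + α * σ * -m) + (4 : ℤ) • (-m * σ * -m) = x →
        m * σ * α + α * σ * m = 0 := by
      intro x hx hx'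
      refine end_eq_zero_of_zsmul (k := 4) (by norm_num) ?_
      have := sub_eq_zero.2 (hx'.trans hx.symm)
      rw [← this]; noncomm_ring
    have opp : ∀ x : Module.End ℤ A,
        α * σ * α - (2 : ℤ) • (m * σ * α + α * σ * m) + (4 : ℤ) • (m * σ * m) = x →
        α * σ * α - (2 : ℤ) • (-m * σ * α + α * σ * -m) + (4 : ℤ) • (-m * σ * -m) = -x →
        α * σ * α + (4 : ℤ) • (m * σ * m) = 0 := by
      intro x hx hx'
      refine end_eq_zero_of_zsmul (k := 2) (by norm_num) ?_
      have : _ + _ = (0 : Module.End ℤ A) := (congrArg₂ (· + ·) hx hx').trans (add_neg_cancel x)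
      rw [← this]; noncomm_ring
    rcases t1 with t1 | t1 <;> rcases t2 with t2 | t2
    · exact Or.inl (same _ t1 t2)
    · exact Or.inr (opp _ t1 t2)
    · exact Or.inr (opp _ t1 (by rw [t2, neg_neg]))
    · exact Or.inl (same _ t1 t2)
  rcases pm n h1 h2 with h3 | h3
  · exact Or.inl h3
  rcases pm ((2 : ℤ) • n) (by rw [mul_smul_comm, h1]) (by rw [smul_mul_assoc, h2, smul_neg]) with
    h4 | h4
  · left
    refine end_eq_zero_of_zsmul (k := 2) (by norm_num) ?_
    rw [← h4]; noncomm_ring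
  · right
    have h5 : α * σ * α = 0 := by
      refine end_eq_zero_of_zsmul (k := 3) (by norm_num) ?_
      have e : (3 : ℤ) • (α * σ * α) = (4 : ℤ) • (α * σ * α + (4 : ℤ) • (n * σ * n)) -
          (α * σ * α + (4 : ℤ) • ((2 : ℤ) • n * σ * (2 : ℤ) • n)) := by noncomm_ring
      rw [e, h3, h4, smul_zero, sub_zero]
    calc σ = α * α * σ * (α * α) := by rw [hα, one_mul, mul_one]
      _ = α * (α * σ * α) * α := by noncomm_ring
      _ = 0 := by rw [h5, mul_zero, zero_mul]

theorem TwistsTo.apply {α σ τ : Module.End ℤ A} (h : TwistsTo α σ τ) (hα : α * α = 1)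
    (hσ : σ ≠ 0) (f : A →ₗ[ℤ] ℤ) {v x : A} (hv : α v = v) (hx : α x = -x) :
    f (σ x - α (σ x)) • v = (2 * f x) • σ v := by
  have hαα : ∀ y, α (α y) = y := fun y => LinearMap.congr_fun hα y
  -- A map of rank at most one, with values in the `+1` eigenspace and vanishing on it, as
  -- `anticomm` requires.
  let n : Module.End ℤ A := (f.comp (1 - α)).smulRight v
  have hn : ∀ y, n y = f (y - α y) • v := fun y => rfl
  have h1 : α * n = n := by
    ext y
    rw [Module.End.mul_apply, hn, map_smul, hv]
  have h2 : n * α = -n := by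
    ext y
    rw [Module.End.mul_apply, LinearMap.neg_apply, hn, hn, hαα, ← neg_smul, ← map_neg, neg_sub]
  have h3 := LinearMap.congr_fun ((h.anticomm hα h1 h2).resolve_right hσ) x
  simp only [LinearMap.add_apply, Module.End.mul_apply, LinearMap.zero_apply, hn, hx, map_neg,
    map_smul] at h3
  have h4 := congrArg α h3
  simp only [map_add, map_neg, map_smul, hαα, hv, map_zero, sub_neg_eq_add] at h4
  rw [← two_mul, neg_add_eq_zero] at h4
  exact h4

/-- Only a scalar `σ` is sent to `±τ` by all the conjugates of a non-scalar involution `α`. -/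
theorem TwistsTo.eq_smul_one {α σ τ : Module.End ℤ A} (h : TwistsTo α σ τ) (hα : α * α = 1)
    (h1 : α ≠ 1) (h2 : α ≠ -1) : ∃ k : ℤ, σ = k • (1 : Module.End ℤ A) := by
  rcases eq_or_ne σ 0 with hσ | hσ
  · exact ⟨0, by rw [hσ, zero_smul]⟩
  have hαα : ∀ y, α (α y) = y := fun y => LinearMap.congr_fun hα y
  have hneg : ∀ y, α (y - α y) = -(y - α y) := fun y => by rw [map_sub, hαα, neg_sub]
  have hpos : ∀ y, α (y + α y) = y + α y := fun y => by rw [map_add, hαα, add_comm]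
  -- Since `α` is neither `1` nor `-1`, both eigenspaces are nonzero. On the `+1` eigenspace `σ`
  -- acts as the rational scalar `d / (2 f x)` and on the other one as `d' / (2 g v)`.
  obtain ⟨x, hx0, hx⟩ : ∃ x, x ≠ 0 ∧ α x = -x := by
    by_contra! hcon
    refine h1 (LinearMap.ext fun y => ?_)
    by_contra hy
    exact hcon (y - α y) (sub_ne_zero.2 fun e => hy e.symm) (hneg y)
  obtain ⟨v, hv0, hv⟩ : ∃ v, v ≠ 0 ∧ α v = v := by
    by_contra! hcon
    refine h2 (LinearMap.ext fun y => ?_)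
    by_contra hy
    refine hcon (y + α y) (fun e => hy ?_) (hpos y)
    exact eq_neg_of_add_eq_zero_right e
  obtain ⟨f, hf⟩ := exists_functional hx0
  obtain ⟨g, hg⟩ := exists_functional hv0
  have e1 : ∀ w, α w = w → f (σ x - α (σ x)) • w = (2 * f x) • σ w := fun w hw =>
    h.apply hα hσ f hw hx
  have e2 : ∀ y, α y = -y → g (σ v + α (σ v)) • y = (2 * g v) • σ y := fun y hy => by
    have := h.neg.apply (by rw [neg_mul_neg, hα]) hσ g (v := y) (x := v)
      (by rw [LinearMap.neg_apply, hy, neg_neg]) (by rw [LinearMap.neg_apply, hv])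
    rwa [LinearMap.neg_apply, sub_neg_eq_add] at this
  set d := f (σ x - α (σ x)) with hd
  set d' := g (σ v + α (σ v)) with hd'
  -- The two rational scalars agree.
  have e3 : 2 * f x * d' = d * (2 * g v) := by
    have h3 := e1 v hv
    have h4 : (2 * f x) • (σ v + α (σ v)) = (2 * d) • v := by
      rw [smul_add, ← map_smul α, ← h3, map_smul α, hv, two_mul, add_smul]
    have h5 := congrArg g h4
    rw [map_smul, map_smul, smul_eq_mul, smul_eq_mul, ← hd'] at h5
    linarith
  have e4 : ∀ y, (2 * f x) • σ y = d • y := by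
    intro y
    have h3 := e1 (y + α y) (hpos y)
    have h4 := e2 (y - α y) (hneg y)
    -- The eigenspaces need not span `A`, but `2y` is the sum of `y + α y` and `y - α y`, which
    -- accounts for the extra factor `2`.
    have h5 : (2 * g v * 2) • ((2 * f x) • σ y - d • y) = 0 := by
      have a1 : (2 * g v) • (2 * f x) • σ (y + α y) = (2 * g v * d) • (y + α y) := by
        rw [← h3, smul_smul]
      have a2 : (2 * g v) • (2 * f x) • σ (y - α y) = (2 * g v * d) • (y - α y) := by
        rw [smul_comm, ← h4, smul_smul, e3, mul_comm]
      have a3 := congrArg₂ (· + ·) a1 a2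
      simp only [← smul_add, ← map_add, add_add_sub_cancel, ← two_smul ℤ y] at a3
      rw [map_smul] at a3
      rw [smul_sub, sub_eq_zero]
      simp only [smul_smul] at a3 ⊢
      convert a3 using 2 <;> ring
    exact sub_eq_zero.1 (eq_zero_of_zsmul (mul_ne_zero (mul_ne_zero two_ne_zero hg) two_ne_zero) h5)
  obtain ⟨i⟩ : Nonempty (Module.Free.ChooseBasisIndex ℤ A) := by
    by_contra hemp
    rw [not_nonempty_iff] at hemp
    exact hx0 ((Module.Free.chooseBasis ℤ A).repr.injective (Subsingleton.elim _ _))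
  let b := Module.Free.chooseBasis ℤ A
  -- The rational scalar is an integer, being a diagonal entry of `σ` in a basis.
  have hc : (2 * f x) * b.repr (σ (b i)) i = d := by
    have h3 := DFunLike.congr_fun (congrArg b.repr (e4 (b i))) i
    simpa using h3
  refine ⟨b.repr (σ (b i)) i, LinearMap.ext fun y => ?_⟩
  refine sub_eq_zero.1 (eq_zero_of_zsmul (k := 2 * f x) (mul_ne_zero two_ne_zero hf) ?_)
  rw [smul_sub, e4 y, LinearMap.smul_apply, Module.End.one_apply, smul_smul, hc, sub_self]

theorem eq_one_or_neg_one_of_smul [Nontrivial A] {σ τ : Module.End ℤ A} (h : σ * τ = 1) {k : ℤ}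
    (hk : σ = k • (1 : Module.End ℤ A)) : σ = 1 ∨ σ = -1 := by
  let b := Module.Free.chooseBasis ℤ A
  obtain ⟨i⟩ := b.index_nonempty
  have h1 : k * b.repr (τ (b i)) i = 1 := by
    rw [hk] at h
    have h3 := DFunLike.congr_fun (congrArg b.repr (LinearMap.congr_fun h (b i))) i
    simpa using h3
  rcases Int.eq_one_or_neg_one_of_mul_eq_one h1 with rfl | rfl
  · left; rw [hk, one_smul]
  · right; rw [hk, neg_one_smul]

/-- A non-scalar involution has a nontrivial square-zero endomorphism. -/
theorem exists_sq_zero {α : Module.End ℤ A} (hα : α * α = 1) (h1 : α ≠ 1) (h2 : α ≠ -1) :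
    ∃ n : Module.End ℤ A, n * n = 0 ∧ n ≠ 0 := by
  by_contra! h
  -- If `0` were the only square-zero map, the twisting condition would hold trivially and force `α`
  -- to be scalar.
  have h3 : TwistsTo α α α := by
    intro n hn
    left
    rw [h n hn, add_zero, sub_zero, one_mul, mul_one, hα, one_mul]
  obtain ⟨k, hk⟩ := h3.eq_smul_one hα h1 h2
  have : Nontrivial A := by
    by_contra hA
    rw [not_nontrivial_iff_subsingleton] at hA
    exact h1 (LinearMap.ext fun x => Subsingleton.elim _ _)
  rcases eq_one_or_neg_one_of_smul hα hk with h4 | h4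
  · exact h1 h4
  · exact h2 h4

end Linear

/-! ### The converse direction of the criterion for involutions. -/

section Involutions

variable {N : Type u} [Group N] {s : ℕ} {B : Set N}

/-- Start from a lift `σ` of a nontrivial unipotent and choose the conjugates one at a time. If
every choice made the next word act as `±1`, the present word would be scalar on `A`, hence `±1`,
against the induction hypothesis. -/
theorem exists_sigmaWord_nonscalar (hs : 1 ≤ s) (hB : IsBasis s B) {θ : MulAut N}
    (hθ : θ * θ = 1) (h1 : abAction θ ≠ 1) (h2 : abAction θ ≠ -1) (m : ℕ) :
    ∃ (σ : MulAut N) (φ : Fin m → MulAut N), (∀ i, IsConj θ (φ i)) ∧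
      abAction (sigmaWord σ m φ) ≠ 1 ∧ abAction (sigmaWord σ m φ) ≠ -1 := by
  have := hB.free hs
  have : Nontrivial (Additive (Abelianization N)) := by
    by_contra hA
    rw [not_nontrivial_iff_subsingleton] at hA
    exact h1 (LinearMap.ext fun x => Subsingleton.elim _ _)
  have hα : abAction θ * abAction θ = 1 := by rw [← map_mul, hθ, map_one]
  have unip : ∀ n : Module.End ℤ (Additive (Abelianization N)), n * n = 0 →
      ∃ τ : MulAut N, abAction τ = 1 + n ∧ abAction τ⁻¹ = 1 - n := by
    intro n hn
    have e1 : (1 + n) * (1 - n) = 1 := by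
      rw [mul_sub, mul_one, add_mul, one_mul, hn, add_zero, add_sub_cancel_right]
    have e2 : (1 - n) * (1 + n) = 1 := by
      rw [mul_add, mul_one, sub_mul, one_mul, hn, sub_zero, sub_add_cancel]
    obtain ⟨τ, hτ⟩ := hB.exists_aut e1 e2
    refine ⟨τ, hτ, ?_⟩
    have e3 : abAction τ⁻¹ * (1 + n) = 1 := by
      rw [← hτ, ← map_mul, inv_mul_cancel, map_one]
    calc abAction τ⁻¹ = abAction τ⁻¹ * ((1 + n) * (1 - n)) := by rw [e1, mul_one]
      _ = 1 - n := by rw [← mul_assoc, e3, one_mul]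
  induction m with
  | zero =>
    obtain ⟨n, hn, hn0⟩ := exists_sq_zero hα h1 h2
    obtain ⟨τ, hτ, -⟩ := unip n hn
    refine ⟨τ, Fin.elim0, fun i => i.elim0, ?_, ?_⟩
    · change abAction τ ≠ 1
      rw [hτ]
      exact fun h => hn0 (by simpa using h)
    · change abAction τ ≠ -1
      rw [hτ]
      intro h
      -- If `1 + n = -1`, then `n = -2` and `n² = 4 ≠ 0`.
      have h3 : n = (-2 : ℤ) • (1 : Module.End ℤ (Additive (Abelianization N))) := by
        have : n = (1 + n) - 1 := by abel
        rw [this, h]; noncomm_ring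
      have h4 : (4 : ℤ) • (1 : Module.End ℤ (Additive (Abelianization N))) = 0 := by
        rw [← hn, h3]; noncomm_ring
      exact one_ne_zero (end_eq_zero_of_zsmul (by norm_num) h4)
  | succ m ih =>
    obtain ⟨σ, φ, hφ, hs1, hs2⟩ := ih
    set w := sigmaWord σ m φ with hw
    have step : ∀ v : MulAut N, ∃ ψ : MulAut N, IsConj θ ψ ∧
        abAction (ψ * w * ψ * v) ≠ 1 ∧ abAction (ψ * w * ψ * v) ≠ -1 := by
      intro v
      by_contra! hcon
      -- Only conjugators lifting unipotents `1 + n` are used; `v` is `w⁻¹` or `w` according to the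
      -- parity of `m`.
      have htw : TwistsTo (abAction θ) (abAction w) (abAction v⁻¹) := by
        intro n hn
        obtain ⟨τ, hτ, hτ'⟩ := unip n hn
        have h3 := hcon (τ * θ * τ⁻¹) (isConj_iff.2 ⟨τ, rfl⟩)
        have h4 : abAction (τ * θ * τ⁻¹ * w * (τ * θ * τ⁻¹)) =
            abAction (τ * θ * τ⁻¹ * w * (τ * θ * τ⁻¹) * v) * abAction v⁻¹ := by
          rw [← map_mul, mul_inv_cancel_right]
        rw [← hτ, ← hτ', ← map_mul, ← map_mul, ← map_mul, ← map_mul, h4]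
        by_cases h5 : abAction (τ * θ * τ⁻¹ * w * (τ * θ * τ⁻¹) * v) = 1
        · left; rw [h5, one_mul]
        · right; rw [h3 h5, neg_one_mul]
      obtain ⟨k, hk⟩ := htw.eq_smul_one hα h1 h2
      have h6 : abAction w * abAction w⁻¹ = 1 := by rw [← map_mul, mul_inv_cancel, map_one]
      rcases eq_one_or_neg_one_of_smul h6 hk with h7 | h7
      · exact hs1 h7
      · exact hs2 h7
    have fin : ∀ ψ : MulAut N, IsConj θ ψ → ∀ i,
        IsConj θ (Fin.snoc (α := fun _ => MulAut N) φ ψ i) := by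
      intro ψ hψ i
      refine Fin.lastCases ?_ (fun j => ?_) i
      · rw [Fin.snoc_last]; exact hψ
      · rw [Fin.snoc_castSucc]; exact hφ j
    by_cases hm : Even m
    · obtain ⟨ψ, hψ, h3, h4⟩ := step w⁻¹
      refine ⟨σ, Fin.snoc (α := fun _ => MulAut N) φ ψ, fin ψ hψ, ?_⟩
      rw [sigmaWord, if_pos hm, Fin.snoc_last, Fin.init_snoc]
      exact ⟨h3, h4⟩
    · obtain ⟨ψ, hψ, h3, h4⟩ := step w
      refine ⟨σ, Fin.snoc (α := fun _ => MulAut N) φ ψ, fin ψ hψ, ?_⟩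
      rw [sigmaWord, if_neg hm, Fin.snoc_last, Fin.init_snoc]
      exact ⟨h3, h4⟩

/-- The characterization of the symmetries modulo `IA(N)` among the involutions. -/
theorem isSymmetryModIA_iff_sigmaWord (hs : 1 ≤ s) (hN : IsFreeNilpotent s N) {θ : MulAut N}
    (hθ1 : θ ≠ 1) (hθ : θ * θ = 1) :
    IsSymmetryModIA s θ ↔ ∀ (σ : MulAut N) (θs : Fin s → MulAut N), (∀ i, IsConj θ (θs i)) →
      sigmaWord σ s θs = 1 := by
  rw [isSymmetryModIA_iff hN]
  constructor
  · exact fun h σ θs hθs => sigmaWord_eq_one_of_isNegOnAb hN h hθ σ θs hθs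
  · intro h
    obtain ⟨B, hB⟩ := hN
    rw [isNegOnAb_iff]
    by_contra h2
    have h1 : abAction θ ≠ 1 := fun h3 =>
      hθ1 (hB.eq_one_of_sq_eq_one (cong_two_iff_abAction.2 h3) hθ)
    obtain ⟨σ, φ, hφ, h3, -⟩ := exists_sigmaWord_nonscalar hs hB hθ h1 h2 s
    exact h3 (by rw [h σ φ hφ, map_one])

end Involutions
end FreeNilp

namespace FreeNilp

/-! ### First-order formulas uniform over all groups. -/

section Definability

open scoped commutatorElement

/-- A property of tuples in groups is uniformly definable if a single formula defines it. -/
def UniformlyDefinable {α : Type} (P : ∀ (G : Type u) [Group G], (α → G) → Prop) : Prop :=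
  ∃ Φ : groupLanguage.Formula α, ∀ (G : Type u) [Group G] (v : α → G), Φ.Realize v ↔ P G v

variable {α β : Type}

theorem exists_term (w : FreeGroup α) : ∃ t : groupLanguage.Term α,
    ∀ (G : Type u) [Group G] (v : α → G), t.realize v = FreeGroup.lift v w := by
  have inv : ∀ t : groupLanguage.Term α, ∃ t' : groupLanguage.Term α,
      ∀ (G : Type u) [Group G] (v : α → G), t'.realize v = (t.realize v)⁻¹ := fun t =>
    ⟨.func (l := 1) (GroupFunc.inv : groupLanguage.Functions 1) fun _ => t, fun G _ v => rfl⟩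
  induction w using FreeGroup.induction_on with
  | C1 =>
    refine ⟨.func (l := 0) (GroupFunc.one : groupLanguage.Functions 0) Fin.elim0, fun G _ v => ?_⟩
    rw [map_one]; rfl
  | of a => exact ⟨.var a, fun G _ v => by rw [FreeGroup.lift_apply_of]; rfl⟩
  | inv_of a h =>
    obtain ⟨t, ht⟩ := h
    obtain ⟨t', ht'⟩ := inv t
    exact ⟨t', fun G _ v => by rw [ht', ht, map_inv]⟩
  | mul v w hv hw =>
    obtain ⟨t, ht⟩ := hv
    obtain ⟨t', ht'⟩ := hw
    refine ⟨.func (l := 2) (GroupFunc.mul : groupLanguage.Functions 2) ![t, t'], fun G _ v => ?_⟩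
    rw [map_mul, ← ht, ← ht']; rfl

theorem UniformlyDefinable.word (w : FreeGroup α) :
    UniformlyDefinable.{u} fun G _ (v : α → G) => FreeGroup.lift v w = 1 := by
  obtain ⟨t, ht⟩ := exists_term.{u} w
  obtain ⟨t1, ht1⟩ := exists_term.{u} (1 : FreeGroup α)
  refine ⟨t.equal t1, fun G _ v => ?_⟩
  rw [FirstOrder.Language.Formula.realize_equal, ht, ht1, map_one]

theorem UniformlyDefinable.not {P : ∀ (G : Type u) [Group G], (α → G) → Prop}
    (h : UniformlyDefinable P) : UniformlyDefinable fun G _ v => ¬ P G v := by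
  obtain ⟨Φ, hΦ⟩ := h
  exact ⟨Φ.not, fun G _ v => by rw [FirstOrder.Language.Formula.realize_not, hΦ]⟩

theorem UniformlyDefinable.imp {P Q : ∀ (G : Type u) [Group G], (α → G) → Prop}
    (h : UniformlyDefinable P) (h' : UniformlyDefinable Q) :
    UniformlyDefinable fun G _ v => P G v → Q G v := by
  obtain ⟨Φ, hΦ⟩ := h
  obtain ⟨Ψ, hΨ⟩ := h'
  exact ⟨Φ.imp Ψ, fun G _ v => by rw [FirstOrder.Language.Formula.realize_imp, hΦ, hΨ]⟩

theorem UniformlyDefinable.or {P Q : ∀ (G : Type u) [Group G], (α → G) → Prop}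
    (h : UniformlyDefinable P) (h' : UniformlyDefinable Q) :
    UniformlyDefinable fun G _ v => P G v ∨ Q G v := by
  obtain ⟨Φ, hΦ⟩ := h
  obtain ⟨Ψ, hΨ⟩ := h'
  exact ⟨Φ ⊔ Ψ, fun G _ v => by rw [FirstOrder.Language.Formula.realize_sup, hΦ, hΨ]⟩

theorem UniformlyDefinable.and {P Q : ∀ (G : Type u) [Group G], (α → G) → Prop}
    (h : UniformlyDefinable P) (h' : UniformlyDefinable Q) :
    UniformlyDefinable fun G _ v => P G v ∧ Q G v := by
  obtain ⟨Φ, hΦ⟩ := h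
  obtain ⟨Ψ, hΨ⟩ := h'
  exact ⟨Φ ⊓ Ψ, fun G _ v => by rw [FirstOrder.Language.Formula.realize_inf, hΦ, hΨ]⟩

theorem UniformlyDefinable.forall_finite {J : Type} [Finite J]
    {P : J → ∀ (G : Type u) [Group G], (α → G) → Prop} (h : ∀ j, UniformlyDefinable (P j)) :
    UniformlyDefinable fun G _ v => ∀ j, P j G v := by
  choose Φ hΦ using h
  refine ⟨FirstOrder.Language.Formula.iInf Φ, fun G _ v => ?_⟩
  rw [FirstOrder.Language.Formula.realize_iInf]
  exact forall_congr' fun j => hΦ j G v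

theorem UniformlyDefinable.forall_tuple [Finite β]
    {P : ∀ (G : Type u) [Group G], (α ⊕ β → G) → Prop} (h : UniformlyDefinable P) :
    UniformlyDefinable fun G _ v => ∀ w : β → G, P G (Sum.elim v w) := by
  obtain ⟨Φ, hΦ⟩ := h
  refine ⟨Φ.iAlls β, fun G _ v => ?_⟩
  rw [FirstOrder.Language.Formula.realize_iAlls]
  exact forall_congr' fun w => hΦ G (Sum.elim v w)

/-- Evaluating the word once in a free group on the variables yields a term valid in every group. -/
theorem map_sigmaWord {G H : Type*} [Group G] [Group H] (f : G →* H) (σ : G) (m : ℕ) :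
    ∀ φ : Fin m → G, f (sigmaWord σ m φ) = sigmaWord (f σ) m fun i => f (φ i) := by
  induction m with
  | zero => intro _; rfl
  | succ m ih =>
    intro φ
    have e : (Fin.init fun i => f (φ i)) = fun i => f (Fin.init φ i) := rfl
    rw [sigmaWord, sigmaWord, e, ← ih]
    split_ifs <;> simp only [map_mul, map_inv]

/-- The first-order condition that describes the involutions among the symmetries modulo
`IA`. -/
def InvolutiveSymmetry (s : ℕ) (G : Type u) [Group G] (y : G) : Prop :=
  ¬ y = 1 ∧ y * y = 1 ∧ ∀ w : Option (Fin s) → G,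
    sigmaWord (w none) s (fun i => w (some i) * y * (w (some i))⁻¹) = 1

/-- In the quantified tuple the coordinate `none` stands for `σ` and the others for the conjugators
that produce the conjugates of `y`. -/
theorem UniformlyDefinable.involutiveSymmetry (s : ℕ) (a : α) :
    UniformlyDefinable.{u} fun G _ (v : α → G) => InvolutiveSymmetry s G (v a) := by
  obtain ⟨Φ, hΦ⟩ := (((UniformlyDefinable.word.{u} (FreeGroup.of a)).not).and
    ((UniformlyDefinable.word.{u} (FreeGroup.of a * FreeGroup.of a)).and
      (UniformlyDefinable.word.{u} (sigmaWord (FreeGroup.of (Sum.inr none)) s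
        (fun i => FreeGroup.of (Sum.inr (some i)) * FreeGroup.of (Sum.inl a) *
          (FreeGroup.of (Sum.inr (some i)))⁻¹) :
            FreeGroup (α ⊕ Option (Fin s)))).forall_tuple))
  refine ⟨Φ, fun G _ v => ?_⟩
  rw [hΦ]
  simp only [map_sigmaWord, map_mul, map_inv, FreeGroup.lift_apply_of, Sum.elim_inl, Sum.elim_inr]
  rfl

/-- The left-normed commutator `⁅⁅g, ρ 0⁆, …, ρ (k - 1)⁆`. -/
def commWord {G : Type*} [Group G] (g : G) : (k : ℕ) → (Fin k → G) → G
  | 0, _ => g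
  | k + 1, ρ => ⁅commWord g k (Fin.init ρ), ρ (Fin.last k)⁆

theorem map_commWord {G H : Type*} [Group G] [Group H] (f : G →* H) (g : G) (m : ℕ) :
    ∀ ρ : Fin m → G, f (commWord g m ρ) = commWord (f g) m fun i => f (ρ i) := by
  induction m with
  | zero => intro _; rfl
  | succ m ih =>
    intro ρ
    rw [commWord, commWord, map_commutatorElement, ih]
    rfl

theorem commWord_const_succ {G : Type*} [Group G] (g c : G) (m : ℕ) :
    commWord g (m + 1) (fun _ => c) = ⁅commWord g m (fun _ => c), c⁆ := rfl

/-- The first-order condition that describes the symmetries modulo `IA` for non-abelian free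
nilpotent groups. -/
def NegatesProducts (s k : ℕ) (G : Type u) [Group G] (θ : G) : Prop :=
  ∀ w : Option (Fin k) ⊕ Option (Fin k) → G, (∀ j, InvolutiveSymmetry s G (w j)) →
    commWord (θ * (w (.inl none) * w (.inr none)) * θ⁻¹ * (w (.inl none) * w (.inr none))) k
      (fun i => w (.inl (some i)) * w (.inr (some i))) = 1

/-- A word `t` is allowed in place of a variable so that the condition can also be imposed on the
identity, which separates abelian from non-abelian `N`. -/
theorem UniformlyDefinable.negatesProducts (s k : ℕ) (t : FreeGroup α) :
    UniformlyDefinable.{u} fun G _ (v : α → G) =>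
      NegatesProducts s k G (FreeGroup.lift v t) := by
  let x : Option (Fin k) ⊕ Option (Fin k) → FreeGroup (α ⊕ (Option (Fin k) ⊕ Option (Fin k))) :=
    fun j => FreeGroup.of (Sum.inr j)
  let t' : FreeGroup (α ⊕ (Option (Fin k) ⊕ Option (Fin k))) := FreeGroup.map Sum.inl t
  obtain ⟨Φ, hΦ⟩ := ((UniformlyDefinable.forall_finite
    (J := Option (Fin k) ⊕ Option (Fin k)) fun j =>
      UniformlyDefinable.involutiveSymmetry.{u} s (Sum.inr j : α ⊕ _)).imp
        (UniformlyDefinable.word.{u} (commWord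
          (t' * (x (.inl none) * x (.inr none)) * t'⁻¹ * (x (.inl none) * x (.inr none))) k
          (fun i => x (.inl (some i)) * x (.inr (some i)))))).forall_tuple
  refine ⟨Φ, fun G _ v => ?_⟩
  rw [hΦ]
  have ht' : ∀ w : Option (Fin k) ⊕ Option (Fin k) → G,
      FreeGroup.lift (Sum.elim v w) t' = FreeGroup.lift v t := by
    intro w
    have : (FreeGroup.lift (Sum.elim v w)).comp (FreeGroup.map Sum.inl) = FreeGroup.lift v := by
      ext a; simp
    exact DFunLike.congr_fun this t
  simp only [map_commWord, map_mul, map_inv, ht', x, FreeGroup.lift_apply_of, Sum.elim_inr]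
  rfl

theorem UniformlyDefinable.subsingleton :
    UniformlyDefinable.{u} fun G _ (_ : α → G) => ∀ x : G, x = 1 := by
  obtain ⟨Φ, hΦ⟩ :=
    (UniformlyDefinable.word.{u} (FreeGroup.of (Sum.inr ()) : FreeGroup (α ⊕ Unit))).forall_tuple
  refine ⟨Φ, fun G _ v => ?_⟩
  rw [hΦ]
  simp only [FreeGroup.lift_apply_of, Sum.elim_inr]
  exact ⟨fun h x => h fun _ => x, fun h w => h _⟩

end Definability

/-! ### First-order characterization of all symmetries modulo `IA(N)`. -/

section Symmetries

open scoped commutatorElement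

variable {N : Type u} [Group N] {s : ℕ} {B : Set N}

theorem involutiveSymmetry_iff (hs : 1 ≤ s) (hN : IsFreeNilpotent s N) (y : MulAut N) :
    InvolutiveSymmetry s (MulAut N) y ↔ y ≠ 1 ∧ y * y = 1 ∧ IsNegOnAb y := by
  unfold InvolutiveSymmetry
  refine and_congr_right fun h1 => and_congr_right fun h2 => ?_
  rw [← isSymmetryModIA_iff hN, isSymmetryModIA_iff_sigmaWord hs hN h1 h2]
  constructor
  · intro h σ θs hθs
    choose τ hτ using fun i => isConj_iff.1 (hθs i)
    have := h (fun o => o.elim σ τ)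
    simpa only [Option.elim_none, Option.elim_some, hτ] using this
  · exact fun h w => h _ _ fun i => isConj_iff.2 ⟨_, rfl⟩

theorem IsBasis.isNegOnAb_of_basis (hB : IsBasis s B) {θ : MulAut N}
    (h : ∀ b ∈ B, Cong 2 (θ b) b⁻¹) : IsNegOnAb θ := by
  have h1 : (Abelianization.of.comp θ.toMonoidHom : N →* Abelianization N) =
      (Abelianization.of)⁻¹ := hB.hom_ext fun b hb => h b hb
  exact fun x => DFunLike.congr_fun h1 x

theorem IsBasis.notMem_gam_two (hs : 1 ≤ s) (hB : IsBasis s B) {b : N} (hb : b ∈ B) :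
    b ∉ gam N 2 := by
  have e : pres B (FreeGroup.of ⟨b, hb⟩) = b := FreeGroup.lift_apply_of
  intro h
  rw [← e, hB.pres_mem_iff (by omega), gam_eq_dimSubgroup _ (by omega)] at h
  have := (Lead.of (⟨b, hb⟩ : B)).eq_zero h (w := [⟨b, hb⟩]) rfl
  simp [coef] at this

theorem IsBasis.sq_ne_one (hs : 1 ≤ s) (hB : IsBasis s B) {b : N} (hb : b ∈ B) :
    b ^ 2 ∉ gam N 2 := fun h =>
  hB.notMem_gam_two hs hb (hB.mem_gam_of_sq_mem le_rfl hs (mem_gam_one b) h)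

theorem homogOp_congr {X : Type u} {n : ℕ} {κ l : List X → ℤ}
    (h : ∀ w : List X, w.length = n → κ w = l w) : homogOp n κ = homogOp n l := by
  refine LinearMap.ext fun f => funext fun w => ?_
  simp only [homogOp_apply]
  split_ifs with hw
  · rw [h _ (by rw [List.length_take]; omega)]
  · rfl

/-- In the leading polynomial of the commutator the word `x c ⋯ c` has coefficient `(-2) ^ m * κ
[x]`: as `x ≠ c`, only products with all letters `c` on the right contribute. -/
theorem Lead.coef_eq_zero_of_commWord {X : Type u} {g : FreeGroup X} {κ : List X → ℤ}
    (hg : Lead g 1 κ) {c x : X} (hx : x ≠ c) (m : ℕ)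
    (h : commWord g m (fun _ => (FreeGroup.of c)⁻¹ * (FreeGroup.of c)⁻¹) ∈
      gam (FreeGroup X) (m + 2)) : κ [x] = 0 := by
  have hc : Lead ((FreeGroup.of c)⁻¹ * (FreeGroup.of c)⁻¹) 1 (-coef (.of c) + -coef (.of c)) :=
    (Lead.of c).inv.mul (Lead.of c).inv
  have key : ∀ m, ∃ l : List X → ℤ,
      Lead (commWord g m fun _ => (FreeGroup.of c)⁻¹ * (FreeGroup.of c)⁻¹) (m + 1) l ∧
      l (x :: List.replicate m c) = (-2) ^ m * κ [x] := by
    intro m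
    induction m with
    | zero => exact ⟨κ, hg, by simp⟩
    | succ m ih =>
      obtain ⟨l, hl, hlx⟩ := ih
      refine ⟨_, hl.comm hc, ?_⟩
      have e : x :: List.replicate (m + 1) c = (x :: List.replicate m c) ++ [c] := by
        rw [List.replicate_succ', List.cons_append]
      have e1 : (x :: List.replicate (m + 1) c).take (m + 1) = x :: List.replicate m c := by
        rw [e, List.take_left' (by simp)]
      have e2 : (x :: List.replicate (m + 1) c).drop (m + 1) = [c] := by
        rw [e, List.drop_left' (by simp)]
      have e3 : (x :: List.replicate (m + 1) c).take 1 = [x] := rfl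
      have hxc : [x] ≠ [c] := by simpa using hx
      rw [polyBracket, e1, e2, e3, hlx]
      simp only [coef, Pi.add_apply, Pi.neg_apply, if_true, if_neg hxc]
      ring
  obtain ⟨l, hl, hlx⟩ := key m
  rw [gam_eq_dimSubgroup _ (by omega)] at h
  rw [hl.eq_zero h (by simp)] at hlx
  rcases mul_eq_zero.1 hlx.symm with h0 | h0
  · exact absurd h0 (pow_ne_zero _ (by norm_num))
  · exact h0

/-- Every basis element `x` admits another one `c ≠ x`, so each linear coefficient of `g` is killed
by some `c`. -/
theorem IsBasis.mem_gam_two_of_commWord (hs : 1 ≤ s) (hB : IsBasis s B) (hnt : B.Nontrivial)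
    {g : N} (h : ∀ c ∈ B, commWord g (s - 1) (fun _ => c⁻¹ * c⁻¹) = 1) : g ∈ gam N 2 := by
  obtain ⟨g, rfl⟩ := hB.surjective g
  obtain ⟨κ, hκ⟩ := exists_lead_one g
  have h0 : ∀ c x : B, x ≠ c → κ [x] = 0 := by
    intro c x hx
    refine hκ.coef_eq_zero_of_commWord hx (s - 1) ?_
    rw [show s - 1 + 2 = s + 1 by omega, ← hB.pres_mem_iff le_rfl, map_commWord]
    have := h c c.2
    simp only [map_mul, map_inv, FreeGroup.lift_apply_of]
    rw [this]
    exact one_mem _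
  change pres B g ∈ gam N 2
  rw [hB.pres_mem_iff (by omega), gam_eq_dimSubgroup _ (by omega), ← lead_zero_iff]
  rw [Lead, ← homogOp_congr (κ := κ) (l := 0)]
  · exact hκ
  · intro w hw
    obtain ⟨x, rfl⟩ := List.length_eq_one_iff.1 hw
    obtain ⟨c, hc, hcx⟩ := hnt.exists_ne (x : N)
    exact h0 ⟨c, hc⟩ x fun e => hcx (congrArg Subtype.val e).symm

theorem IsBasis.gam_two_eq_bot (hB : IsBasis s B) (h : B.Subsingleton) : gam N 2 = ⊥ := by
  have hcomm : ∀ x y : N, x * y = y * x := by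
    have h1 : ∀ b ∈ B, ∀ y : N, b * y = y * b := by
      intro b hb y
      have : (MulAut.conj b).toMonoidHom = MonoidHom.id N := hB.hom_ext fun c hc => by
        rw [h hc hb]; simp
      have h2 : b * y * b⁻¹ = y := DFunLike.congr_fun this y
      exact mul_inv_eq_iff_eq_mul.1 h2
    intro x y
    have : (MulAut.conj y).toMonoidHom = MonoidHom.id N := hB.hom_ext fun c hc => by
      change y * c * y⁻¹ = c
      rw [← h1 c hc y, mul_inv_cancel_right]
    have h2 : y * x * y⁻¹ = x := DFunLike.congr_fun this x
    exact (mul_inv_eq_iff_eq_mul.1 h2).symm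
  rw [gam_succ 1 le_rfl, eq_bot_iff, Subgroup.commutator_le]
  intro x _ y _
  exact Subgroup.mem_bot.2 (commutatorElement_eq_one_iff_mul_comm.2 (hcomm x y))

theorem InvolutiveSymmetry.conj (hs : 1 ≤ s) (hN : IsFreeNilpotent s N) {y : MulAut N}
    (h : InvolutiveSymmetry s (MulAut N) y) (τ : MulAut N) :
    InvolutiveSymmetry s (MulAut N) (τ * y * τ⁻¹) := by
  rw [involutiveSymmetry_iff hs hN] at *
  obtain ⟨h1, h2, h3⟩ := h
  refine ⟨fun e => h1 (conj_eq_one_iff.1 e), ?_, h3.conj τ⟩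
  rw [conj_mul, h2, mul_one, mul_inv_cancel]

/-- Since `y` inverts `b`, it conjugates the inner automorphism of `b` to its inverse. This exhibits
inner automorphisms as products of two involutive symmetries. -/
theorem mul_conj_conj_eq {y : MulAut N} (hyy : y * y = 1) {b : N} (hy : y b = b⁻¹) :
    y * (MulAut.conj b * y * (MulAut.conj b)⁻¹) = MulAut.conj (b⁻¹ * b⁻¹) := by
  ext x
  have hyx : y (y x) = x := DFunLike.congr_fun hyy x
  simp only [MulAut.mul_apply, MulAut.conj_apply, MulAut.conj_inv_apply, map_mul, map_inv, hyx,
    hy, mul_inv_rev, inv_inv, mul_assoc]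

theorem IsBasis.cong_inv_of_mem (hs : 1 ≤ s) (hB : IsBasis s B) (θ : MulAut N) (b : N)
    (h : θ (b⁻¹ * b⁻¹) * (b⁻¹ * b⁻¹) ∈ gam N 2) : Cong 2 (θ b) b⁻¹ := by
  have := hB.free hs
  have e1 : ab (θ (b⁻¹ * b⁻¹) * (b⁻¹ * b⁻¹)) = ab 1 := ab_eq_iff.2 (cong_one_iff.2 h)
  have e2 : (-2 : ℤ) • (ab (θ b) + ab b) = 0 := by
    have e3 : ab (1 : N) = 0 := rfl
    rw [← e3, ← e1]
    simp only [map_mul, map_inv, ab_mul, ab_inv]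
    abel
  rw [← ab_eq_iff, ab_inv]
  exact eq_neg_of_add_eq_zero_left (eq_zero_of_zsmul (by norm_num) e2)

theorem IsBasis.exists_involutiveSymmetry (hs : 1 ≤ s) (hB : IsBasis s B) (hne : B.Nonempty) :
    ∃ y : MulAut N, (∀ b ∈ B, y b = b⁻¹) ∧ y * y = 1 ∧ InvolutiveSymmetry s (MulAut N) y := by
  obtain ⟨y, hy, hyy⟩ := hB.exists_symmetry
  refine ⟨y, hy, hyy, (involutiveSymmetry_iff hs ⟨B, hB⟩ y).2
    ⟨?_, hyy, IsSymmetry.isNegOnAb (s := s) ⟨B, hB, hy⟩⟩⟩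
  rintro rfl
  obtain ⟨b, hb⟩ := hne
  have h1 : b = b⁻¹ := hy b hb
  refine hB.sq_ne_one hs hb ?_
  rw [pow_two]
  nth_rewrite 1 [h1]
  rw [inv_mul_cancel]
  exact one_mem _

/-- With `y` and its conjugates by inner automorphisms as the involutive symmetries, the condition
becomes the triviality of one inner automorphism, namely that of the `(s - 2)`-fold commutator in
`N`. -/
theorem NegatesProducts.commWord_eq_one (hs : 2 ≤ s) (hB : IsBasis s B) {θ : MulAut N}
    (h : NegatesProducts s (s - 2) (MulAut N) θ) {b c : N} (hb : b ∈ B) (hc : c ∈ B) :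
    commWord (θ (b⁻¹ * b⁻¹) * (b⁻¹ * b⁻¹)) (s - 1) (fun _ => c⁻¹ * c⁻¹) = 1 := by
  obtain ⟨y, hy, hyy, hyS⟩ := hB.exists_involutiveSymmetry (by omega) ⟨b, hb⟩
  have conjSym := hyS.conj (by omega) ⟨B, hB⟩
  have h1 := h (Sum.elim (fun _ => y) fun o => o.elim (MulAut.conj b * y * (MulAut.conj b)⁻¹)
    fun _ => MulAut.conj c * y * (MulAut.conj c)⁻¹) (by
      rintro (j | j)
      · exact hyS
      · cases j
        · exact conjSym _
        · exact conjSym _)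
  simp only [Sum.elim_inl, Sum.elim_inr, Option.elim_none, Option.elim_some,
    mul_conj_conj_eq hyy (hy b hb), mul_conj_conj_eq hyy (hy c hc)] at h1
  have h2 : ∀ g, θ * MulAut.conj g * θ⁻¹ = MulAut.conj (θ g) := by
    intro g
    ext x
    simp only [MulAut.mul_apply, MulAut.conj_apply, map_mul, map_inv, MulAut.apply_inv_self]
  rw [h2, ← map_mul, ← map_commWord] at h1
  -- The commutator is central; its commuting with `c⁻²` supplies the last of the `s - 1`
  -- commutators.
  have h3 := DFunLike.congr_fun h1 (c⁻¹ * c⁻¹)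
  rw [MulAut.conj_apply, MulAut.one_apply] at h3
  rw [show s - 1 = s - 2 + 1 by omega, commWord_const_succ, commutatorElement_eq_one_iff_mul_comm]
  exact mul_inv_eq_iff_eq_mul.1 h3

theorem IsBasis.isNegOnAb_of_negatesProducts (hs : 2 ≤ s) (hB : IsBasis s B)
    (hnt : B.Nontrivial) {θ : MulAut N} (h : NegatesProducts s (s - 2) (MulAut N) θ) :
    IsNegOnAb θ :=
  hB.isNegOnAb_of_basis fun b hb => hB.cong_inv_of_mem (by omega) θ b <|
    hB.mem_gam_two_of_commWord (by omega) hnt fun _ hc => h.commWord_eq_one hs hB hb hc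

/-- A product `ρ` of two involutive symmetries has depth `1`; by the odd case of the sign rule
`θρθ⁻¹ρ` has depth `2`, and each of the `s - 2` commutators adds one, up to depth `s`. -/
theorem negatesProducts_of_isNegOnAb (hs : 2 ≤ s) (hN : IsFreeNilpotent s N) {θ : MulAut N}
    (hθ : IsNegOnAb θ) : NegatesProducts s (s - 2) (MulAut N) θ := by
  intro w hw
  have hprod : ∀ i j, ActsTrivially 1 (w i * w j) := by
    intro i j x
    have hi := (((involutiveSymmetry_iff (by omega) hN _).1 (hw i)).2.2)
    have hj := (((involutiveSymmetry_iff (by omega) hN _).1 (hw j)).2.2)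
    have h1 := (hj x).map (w i).toMonoidHom
    have h2 := hi x⁻¹
    rw [inv_inv] at h2
    exact h1.trans h2
  have chain : ∀ (m : ℕ) (σ : MulAut N) (ρ : Fin m → MulAut N), ActsTrivially 2 σ →
      (∀ i, ActsTrivially 1 (ρ i)) → ActsTrivially (2 + m) (commWord σ m ρ) := by
    intro m σ
    induction m with
    | zero => exact fun ρ h _ => h
    | succ m ih => exact fun ρ h hρ => (ih (Fin.init ρ) h fun i => hρ _).comm (hρ _)
  obtain ⟨B, hB⟩ := hN
  refine hB.eq_one_of_actsTrivially ?_
  have := chain (s - 2) _ (fun i => w (.inl (some i)) * w (.inr (some i)))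
    ((hprod (.inl none) (.inr none)).conj_mul (by decide) hθ) (fun i => hprod _ _)
  rwa [show 2 + (s - 2) = s by omega] at this

theorem eq_inv_of_gam_two_eq_bot (h : gam N 2 = ⊥) {θ : MulAut N} (hθ : IsNegOnAb θ) (x : N) :
    θ x = x⁻¹ := by
  have := cong_iff_mul_inv.1 (hθ x)
  rw [h, Subgroup.mem_bot] at this
  exact mul_inv_eq_one.1 this

/-- The first-order characterization of the symmetries modulo `IA(N)`. -/
theorem isSymmetryModIA_iff_firstOrder (hs : 1 ≤ s) (hN : IsFreeNilpotent s N) (θ : MulAut N) :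
    IsSymmetryModIA s θ ↔ (∀ σ : MulAut N, σ = 1) ∨ InvolutiveSymmetry s (MulAut N) θ ∨
      NegatesProducts s (s - 2) (MulAut N) θ ∧ ¬ NegatesProducts s (s - 2) (MulAut N) 1 := by
  rw [isSymmetryModIA_iff hN]
  obtain ⟨B, hB⟩ := id hN
  have hne : ∀ b ∈ B, ¬ Cong 2 b b⁻¹ := by
    intro b hb h
    have := cong_iff_mul_inv.1 h
    rw [inv_inv, ← pow_two] at this
    exact hB.sq_ne_one hs hb this
  constructor
  · intro h
    by_cases hab : gam N 2 = ⊥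
    · by_cases h1 : θ = 1
      · left
        -- If the identity acts as `-1`, the basis must be empty, so `N` and `Aut(N)` are trivial.
        have hemp : ∀ b ∈ B, False := fun b hb => hne b hb (by
          have := h b
          rwa [h1] at this)
        intro σ
        have : σ.toMonoidHom = MonoidHom.id N := hB.hom_ext fun b hb => (hemp b hb).elim
        ext x
        exact DFunLike.congr_fun this x
      · right; left
        rw [involutiveSymmetry_iff hs hN]
        refine ⟨h1, ?_, h⟩
        ext x
        rw [MulAut.mul_apply, eq_inv_of_gam_two_eq_bot hab h, eq_inv_of_gam_two_eq_bot hab h,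
          inv_inv]
        rfl
    · right; right
      have hs2 : 2 ≤ s := by
        by_contra hcon
        obtain rfl : s = 1 := by omega
        exact hab hB.gam_eq_bot
      have hnt : B.Nontrivial := by
        rw [← Set.not_subsingleton_iff]
        exact fun hsub => hab (hB.gam_two_eq_bot hsub)
      refine ⟨negatesProducts_of_isNegOnAb hs2 hN h, fun hcon => ?_⟩
      obtain ⟨b, hb⟩ := hnt.nonempty
      exact hne b hb (hB.isNegOnAb_of_negatesProducts hs2 hnt hcon b)
  · rintro (h | h | ⟨h, h1⟩)
    -- When `Aut(N)` is trivial, `θ` coincides with the symmetry of a basis.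
    · obtain ⟨y, hy, -⟩ := hB.exists_symmetry
      have := IsSymmetry.isNegOnAb (s := s) ⟨B, hB, hy⟩
      rwa [h y, ← h θ] at this
    · exact ((involutiveSymmetry_iff hs hN θ).1 h).2.2
    -- In an abelian `N` every involutive symmetry is inversion, all products of two are `1`, and
    -- the identity satisfies the condition. Its failure for `1` thus forces `N` to be non-abelian.
    · have hab : gam N 2 ≠ ⊥ := by
        intro hab
        refine h1 fun w hw => ?_
        have hw1 : ∀ i j, w i * w j = 1 := by
          intro i j
          ext x
          rw [MulAut.mul_apply,
            eq_inv_of_gam_two_eq_bot hab ((involutiveSymmetry_iff hs hN _).1 (hw i)).2.2,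
            eq_inv_of_gam_two_eq_bot hab ((involutiveSymmetry_iff hs hN _).1 (hw j)).2.2, inv_inv]
          rfl
        simp only [hw1, mul_one, inv_one]
        have : ∀ (m : ℕ), commWord (1 : MulAut N) m (fun _ => 1) = 1 := by
          intro m
          cases m with
          | zero => rfl
          | succ m => exact commutatorElement_one_right _
        exact this _
      -- Class `1` is abelian, so the truncated value of `s - 2` at `s = 1` plays no role.
      have hs2 : 2 ≤ s := by
        by_contra hcon
        obtain rfl : s = 1 := by omega
        exact hab hB.gam_eq_bot
      have hnt : B.Nontrivial := by
        rw [← Set.not_subsingleton_iff]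
        exact fun hsub => hab (hB.gam_two_eq_bot hsub)
      exact hB.isNegOnAb_of_negatesProducts hs2 hnt h

end Symmetries

end FreeNilp

/-- The symmetries modulo `IA(N)` of a free nilpotent group: their description among the
involutions, and their uniform definability in `Aut(N)`. -/
theorem mainTheorem6 (s : ℕ) (hs : 1 ≤ s) :
    (∀ (N : Type u) [Group N], FreeNilp.IsFreeNilpotent s N →
      ∀ θ : MulAut N, orderOf θ = 2 →
        (FreeNilp.IsSymmetryModIA s θ ↔
          ∀ (σ : MulAut N) (θs : Fin s → MulAut N), (∀ i, IsConj θ (θs i)) →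
            FreeNilp.sigmaWord σ s θs = 1)) ∧
    (∃ Φ : FreeNilp.groupLanguage.Formula (Fin 1),
      ∀ (N : Type u) [Group N], FreeNilp.IsFreeNilpotent s N →
        ∀ θ : MulAut N, FreeNilp.IsSymmetryModIA s θ ↔ Φ.Realize (fun _ => θ)) := by
  constructor
  · intro N _ hN θ hθ
    refine FreeNilp.isSymmetryModIA_iff_sigmaWord hs hN (fun h => ?_) ?_
    · rw [h, orderOf_one] at hθ
      exact absurd hθ (by norm_num)
    · rw [← pow_two, ← hθ, pow_orderOf_eq_one]
  · obtain ⟨Φ, hΦ⟩ := (FreeNilp.UniformlyDefinable.subsingleton.{u} (α := Fin 1)).or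
      ((FreeNilp.UniformlyDefinable.involutiveSymmetry.{u} s (0 : Fin 1)).or
        ((FreeNilp.UniformlyDefinable.negatesProducts.{u} s (s - 2) (FreeGroup.of (0 : Fin 1))).and
          (FreeNilp.UniformlyDefinable.negatesProducts.{u} s (s - 2)
            (1 : FreeGroup (Fin 1))).not))
    refine ⟨Φ, fun N _ hN θ => ?_⟩
    rw [hΦ, FreeNilp.isSymmetryModIA_iff_firstOrder hs hN]
    simp only [map_one, FreeGroup.lift_apply_of]
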